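/- **Setting.** Let $d\ge 1$ be an integer and, for $s\in\{1,2\}$, let $\alpha_s,\beta_s,\gamma_s\in[0,1]$ with $\alpha_s+\beta_s+\gamma_s=1$, let $\theta_s\in[0,1]$ with $\theta_1+\theta_2=1$, and let $\pi_s\in(0,1)$ with $\pi_1+\pi_2=1$. The identity-depolarizing-erasure (IDE) channel with state $s$ maps a density operator $\rho$ on $\mathbb C^d$ to the density operator $$\mathcal N^{(s)}(\rho)=\begin{bmatrix}\alpha_s\rho+\beta_s I_d/d&0\\0&\gamma_s\end{bmatrix}$$ on $\mathbb C^{d+1}$. The channel states $S_1,S_2,\dots$ are i.i.d. with $\Pr(S_t=s)=\theta_s$, and they are unknown to transmitter and receiver. **Protocols.** An (entangled) protocol for joint communication and instantaneous detection consists of integers $M,T\ge1$, finite dimensions $a,b$ and $q$, a density operator $\rho$ on $(\mathbb C^a\otimes\mathbb C^b)^{\otimes T}$ for the systems $A_1B_1\cdots A_TB_T$ (arbitrary, hence possibly entangled in space and time), completely positive trace-preserving encoders $\mathcal E^{(w)}_t$ from operators on $\mathbb C^a$ to operators on $\mathbb C^d$ for $w\in\{1,\dots,M\}$ and $t\in\{1,\dots,T\}$,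 a quantum instrument $\{\mathcal M^{(1)},\mathcal M^{(2)}\}$ (completely positive maps whose sum is trace preserving) from operators on $\mathbb C^{d+1}\otimes\mathbb C^b$ to operators on $\mathbb C^q$, and a POVM $\{\Xi^{(w)}\}_{w=1}^M$ on $(\mathbb C^2)^{\otimes T}\otimes(\mathbb C^q)^{\otimes T}$. A message $W$ uniform on $\{1,\dots,M\}$ and independent of the channel states is encoded by applying $\mathcal E^{(W)}_t$ to $A_t$ for every $t$; the output in slot $t$ passes through $\mathcal N^{(S_t)}$; in every slot $t$ the receiver applies the instrument to the channel output together with $B_t$, which yields the estimate $\hat S_t\in\{1,2\}$ and a remaining system $Q_t$; after $T$ slots the POVM, applied to $\hat S_1\cdots\hat S_TQ_1\cdots Q_T$, yields $\hat W$. Put $$P_{\sf c}=\max_w\Pr(\hat W\ne w\mid W=w),\qquad P_{\sf d}=\max_{t}\bigl(\pi_1\Pr(\hat S_t=2\mid S_t=1)+\pi_2\Pr(\hat S_t=1\mid S_t=2)\bigr).$$ Here conditioning on $S_t=s$ means that the channel used in slot $t$ is $\mathcal N^{(s)}$ (so it makes sense also if $\theta_s=0$). A pair $(R,P_{\sf e})\in\mathbb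 R^2$ is achievable by entangled protocols if for every $\epsilon>0$ there is a protocol with $\frac{\log_2M}{T}\ge R-\epsilon$, $P_{\sf c}\le\epsilon$ and $P_{\sf d}\le P_{\sf e}$. Let $\mathfrak R_e^*$ be the set of all such pairs. **The region.** Let $\bar\alpha=\theta_1\alpha_1+\theta_2\alpha_2$ and $\bar\beta=\theta_1\beta_1+\theta_2\beta_2$, and let $h(x)=x\log_2x$ with $h(0)=0$. For an integer $D\ge1$ let $\mathfrak R_1(D)$ be the convex hull of the set of all $(R,P_{\sf e})\in\mathbb R^2$ for which there are $n\in\{1,\dots,D\}$ and $p_1,p_2\in[0,1]$ with $np_1+(D-n)p_2=1$ such that $$R\le-n\,h\!\left(p_1\bar\alpha+\tfrac{\bar\beta}D\right)-(D-n)\,h\!\left(p_2\bar\alpha+\tfrac{\bar\beta}D\right)+h\!\left(\bar\alpha+\tfrac{\bar\beta}D\right)+(D-1)\,h\!\left(\tfrac{\bar\beta}D\right)$$ and $$P_{\sf e}\ge n\min_{s\in\{1,2\}}\left\{\pi_s\alpha_sp_1+\tfrac{\pi_s\beta_s}D\right\}+(D-n)\min_{s\in\{1,2\}}\left\{\pi_s\alpha_sp_2+\tfrac{\pi_s\beta_s}D\right\}+\min\{\pi_1\gamma_1,\pi_2\gamma_2\}.$$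 **Theorem.** $\mathfrak R_1(d^2)\subseteq\mathfrak R_e^*$: every pair in $\mathfrak R_1(d^2)$ is achievable by entangled protocols over the IDE channels. -/

import Mathlib

open scoped ComplexOrder

/-- Operators on the finite-dimensional Hilbert space with computational basis `ι`. -/
abbrev Op (ι : Type) : Type := Matrix ι ι ℂ

/-- The extension `Φ ⊗ id` of a linear map `Φ` on operators by an ancilla with basis `ν`. -/
def tensorId {ι κ : Type} (Φ : Op ι →ₗ[ℂ] Op κ) (ν : Type) :
    Op (ι × ν) →ₗ[ℂ] Op (κ × ν) where
  toFun X := Matrix.of fun k l => Φ (Matrix.of fun i j => X (i, k.2) (j, l.2)) k.1 l.1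
  map_add' X Y := by
    ext k l
    have h : (Matrix.of fun i j => (X + Y) (i, k.2) (j, l.2)) =
        (Matrix.of fun i j => X (i, k.2) (j, l.2) : Op ι) +
          Matrix.of fun i j => Y (i, k.2) (j, l.2) := rfl
    simp only [Matrix.of_apply, Matrix.add_apply] at h ⊢
    rw [h, map_add, Matrix.add_apply]
  map_smul' c X := by
    ext k l
    have h : (Matrix.of fun i j => (c • X) (i, k.2) (j, l.2)) =
        c • (Matrix.of fun i j => X (i, k.2) (j, l.2) : Op ι) := rfl
    simp only [Matrix.of_apply, Matrix.smul_apply, RingHom.id_apply] at h ⊢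
    rw [h, map_smul, Matrix.smul_apply]

/-- Complete positivity: `Φ ⊗ id` is positive for every finite-dimensional ancilla. -/
def IsCompletelyPositive {ι κ : Type} (Φ : Op ι →ₗ[ℂ] Op κ) : Prop :=
  ∀ (n : ℕ) (X : Op (ι × Fin n)), X.PosSemidef → (tensorId Φ (Fin n) X).PosSemidef

/-- Trace preservation. -/
def IsTracePreserving {ι κ : Type} [Fintype ι] [Fintype κ] (Φ : Op ι →ₗ[ℂ] Op κ) : Prop :=
  ∀ X : Op ι, (Φ X).trace = X.trace

/-- Density operators. -/
def IsDensity {ι : Type} [Fintype ι] (ρ : Op ι) : Prop :=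
  ρ.PosSemidef ∧ ρ.trace = 1

/-- The tensor product `Φ 0 ⊗ ⋯ ⊗ Φ (T - 1)` of maps on operators, applied to an operator `X` on the
`T`-fold tensor product space: it is linear in `X` and sends the matrix unit
`⊗ₜ |i t⟩⟨j t|` to `⊗ₜ Φ t (|i t⟩⟨j t|)`. -/
def tensorMaps {T : ℕ} {ι κ : Type} [Fintype ι] [DecidableEq ι]
    (Φ : Fin T → (Op ι →ₗ[ℂ] Op κ)) (X : Op (Fin T → ι)) : Op (Fin T → κ) :=
  Matrix.of fun k l => ∑ i : Fin T → ι, ∑ j : Fin T → ι,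
    X i j * ∏ t, Φ t (Matrix.single (i t) (j t) 1) (k t) (l t)

/-- The reduced operator of the `t`-th tensor factor (partial trace over all other factors). -/
def reduceTo {T : ℕ} {ι : Type} [Fintype ι] [DecidableEq ι]
    (t : Fin T) (X : Op (Fin T → ι)) : Op ι :=
  Matrix.of fun i j => ∑ f : Fin T → ι, if f t = i then X f (Function.update f t j) else 0

/-- A protocol for joint communication and instantaneous detection, for channels whose input space
has dimension `d` and whose output space has basis `κ`. The initial state `ρ` is arbitrary, so it
may be entangled in space and in time. The two channel states and their estimates `1, 2` are
the elements `0, 1` of `Fin 2`. -/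
structure JCIDProtocol (d : ℕ) (κ : Type) [Fintype κ] where
  /-- number of messages -/
  M : ℕ
  /-- number of channel uses -/
  T : ℕ
  M_pos : 0 < M
  T_pos : 0 < T
  /-- dimension of each transmitter system -/
  a : ℕ
  /-- dimension of each receiver system -/
  b : ℕ
  /-- dimension of each system that remains after the instantaneous detection -/
  q : ℕ
  /-- the initial state shared by the transmitter and the receiver -/
  ρ : Op (Fin T → Fin a × Fin b)
  ρ_density : IsDensity ρ
  /-- the encoders -/
  enc : Fin M → Fin T → (Op (Fin a) →ₗ[ℂ] Op (Fin d))
  enc_cp : ∀ w t, IsCompletelyPositive (enc w t)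
  enc_tp : ∀ w t, IsTracePreserving (enc w t)
  /-- the quantum instrument for the instantaneous detection -/
  inst : Fin 2 → (Op (κ × Fin b) →ₗ[ℂ] Op (Fin q))
  inst_cp : ∀ s, IsCompletelyPositive (inst s)
  inst_tp : IsTracePreserving (∑ s, inst s)
  /-- the decoding measurement on all detection results and all remaining systems -/
  povm : Fin M → Op ((Fin T → Fin 2) × (Fin T → Fin q))
  povm_pos : ∀ w, (povm w).PosSemidef
  povm_sum : ∑ w, povm w = 1

namespace JCIDProtocol

variable {d : ℕ} {κ : Type} [Fintype κ] (P : JCIDProtocol d κ)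

/-- The encoded state given the message `w`. -/
def encoded (w : Fin P.M) : Op (Fin P.T → Fin d × Fin P.b) :=
  tensorMaps (fun t => tensorId (P.enc w t) (Fin P.b)) P.ρ

/-- The encoded state for a uniformly random message. -/
noncomputable def avgEncoded : Op (Fin P.T → Fin d × Fin P.b) :=
  (P.M : ℂ)⁻¹ • ∑ w, P.encoded w

/-- The state at the receiver when the systems of the encoded state `σ` that are sent in the slots
`t` pass through the channels `C t`. -/
def transmit (C : Fin P.T → (Op (Fin d) →ₗ[ℂ] Op κ)) (σ : Op (Fin P.T → Fin d × Fin P.b)) :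
    Op (Fin P.T → κ × Fin P.b) :=
  tensorMaps (fun t => tensorId (C t) (Fin P.b)) σ

/-- The classical-quantum state of all detection results and all remaining systems, obtained by
applying the instrument in every slot to the received state `ω`. -/
def afterDetection [DecidableEq κ] (ω : Op (Fin P.T → κ × Fin P.b)) :
    Op ((Fin P.T → Fin 2) × (Fin P.T → Fin P.q)) :=
  Matrix.of fun k l =>
    if k.1 = l.1 then tensorMaps (fun t => P.inst (k.1 t)) ω k.2 l.2 else 0

/-- The overall channel `θ₁ N₁ + θ₂ N₂`. -/
noncomputable def overall (θ : Fin 2 → ℝ) (N : Fin 2 → (Op (Fin d) →ₗ[ℂ] Op κ)) :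
    Op (Fin d) →ₗ[ℂ] Op κ :=
  ∑ s, (θ s : ℂ) • N s

/-- The probability of decoding `w'` when the message is `w`. -/
noncomputable def decodeProb [DecidableEq κ] (θ : Fin 2 → ℝ)
    (N : Fin 2 → (Op (Fin d) →ₗ[ℂ] Op κ)) (w w' : Fin P.M) : ℝ :=
  (P.povm w' * P.afterDetection (P.transmit (fun _ => overall θ N) (P.encoded w))).trace.re

/-- The maximal probability of a decoding error over all messages. -/
noncomputable def commError [DecidableEq κ] (θ : Fin 2 → ℝ)
    (N : Fin 2 → (Op (Fin d) →ₗ[ℂ] Op κ)) : ℝ :=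
  ⨆ w : Fin P.M, ∑ w' ∈ Finset.univ.erase w, P.decodeProb θ N w w'

/-- The probability that the detection result in slot `t` is `s'`, given that the channel state in
slot `t` is `s` (the states in the other slots being independent with law `θ`). -/
noncomputable def detectProb [DecidableEq κ] (θ : Fin 2 → ℝ)
    (N : Fin 2 → (Op (Fin d) →ₗ[ℂ] Op κ)) (t : Fin P.T) (s s' : Fin 2) : ℝ :=
  (P.inst s' (reduceTo t
    (P.transmit (Function.update (fun _ => overall θ N) t (N s)) P.avgEncoded))).trace.re

/-- The worst-case over the slots of the weighted sum of the Type I and Type II errors. -/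
noncomputable def detectError [DecidableEq κ] (θ π : Fin 2 → ℝ)
    (N : Fin 2 → (Op (Fin d) →ₗ[ℂ] Op κ)) : ℝ :=
  ⨆ t : Fin P.T, (π 0 * P.detectProb θ N t 0 1 + π 1 * P.detectProb θ N t 1 0)

end JCIDProtocol

/-- The pairs (rate, detection error) achievable by entangled protocols over the channels `N`. -/
def achievableRegion {d : ℕ} {κ : Type} [Fintype κ] [DecidableEq κ] (θ π : Fin 2 → ℝ)
    (N : Fin 2 → (Op (Fin d) →ₗ[ℂ] Op κ)) : Set (ℝ × ℝ) :=
  {x | ∀ ε : ℝ, 0 < ε → ∃ P : JCIDProtocol d κ,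
    x.1 - ε ≤ Real.logb 2 (P.M : ℝ) / (P.T : ℝ) ∧
    P.commError θ N ≤ ε ∧
    P.detectError θ π N ≤ x.2}

/-- The identity-depolarizing-erasure channel with parameters `α, β, γ`. The basis vector
`Sum.inr ()` of the output space signals an erasure. On density operators (trace one) this is
`ρ ↦ (α ρ + β I / d) ⊕ γ |0⟩⟨0|`, extended linearly to all operators. -/
noncomputable def ideChannel (d : ℕ) (α β γ : ℝ) :
    Op (Fin d) →ₗ[ℂ] Op (Fin d ⊕ Unit) where
  toFun X := Matrix.fromBlocks
    ((α : ℂ) • X + (((β : ℂ) / (d : ℂ)) * X.trace) • (1 : Op (Fin d))) 0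
    0 (((γ : ℂ) * X.trace) • (1 : Op Unit))
  map_add' X Y := by
    ext i j
    rcases i with i | i <;> rcases j with j | j <;>
      simp [Matrix.trace_add] <;> ring
  map_smul' c X := by
    ext i j
    rcases i with i | i <;> rcases j with j | j <;>
      simp [Matrix.trace_smul] <;> ring

/-- `x log₂ x`, which is `0` at `x = 0`. -/
noncomputable def xlog2 (x : ℝ) : ℝ := x * Real.logb 2 x

/-- The explicit rate / detection-error region with `D` signal dimensions: the convex hull
of the pairs given by the probability vectors on `D` points that take one value `p₁` on the first
`n` points and one value `p₂` on the remaining `D - n` points. -/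
def region1 (D : ℕ) (α β γ θ π : Fin 2 → ℝ) : Set (ℝ × ℝ) :=
  let αbar : ℝ := θ 0 * α 0 + θ 1 * α 1
  let βbar : ℝ := θ 0 * β 0 + θ 1 * β 1
  convexHull ℝ {x : ℝ × ℝ | ∃ (n : ℕ) (p₁ p₂ : ℝ),
    1 ≤ n ∧ n ≤ D ∧ 0 ≤ p₁ ∧ p₁ ≤ 1 ∧ 0 ≤ p₂ ∧ p₂ ≤ 1 ∧
    (n : ℝ) * p₁ + ((D : ℝ) - n) * p₂ = 1 ∧
    x.1 ≤ -(n : ℝ) * xlog2 (p₁ * αbar + βbar / D)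
      - ((D : ℝ) - n) * xlog2 (p₂ * αbar + βbar / D)
      + xlog2 (αbar + βbar / D) + ((D : ℝ) - 1) * xlog2 (βbar / D) ∧
    (n : ℝ) * min (π 0 * α 0 * p₁ + π 0 * β 0 / D) (π 1 * α 1 * p₁ + π 1 * β 1 / D)
      + ((D : ℝ) - n) *
        min (π 0 * α 0 * p₂ + π 0 * β 0 / D) (π 1 * α 1 * p₂ + π 1 * β 1 / D)
      + min (π 0 * γ 0) (π 1 * γ 1) ≤ x.2}

/-! Dense coding reduces the problem to a classical one. Every slot shares a maximally entangled
pair and a classical label known to both sides. The encoder applies one of `d ^ 2` mutually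
orthogonal unitaries, the receiver measures in a generalized Bell basis, and by
`quadForm_denseCoding` the IDE channel becomes a classical channel: each of the `d ^ 2` symbols is
received with probability `β / d ^ 2`, the input with an additional `α`, and the erasure event has
probability `γ`.

The label consists of a time-sharing symbol `u` of law `q` and one symbol of law `p u` for each
message. The random codebook is thus part of the shared state, so no derandomization is needed and
the error bound holds for each message separately. Labels are independent and identically
distributed over the slots, so every slot has the same detection error, the `q`-average of Bayes
errors. This realizes the convex hull under the worst-slot criterion, which time sharing by
consecutive blocks would not.

One Bell measurement serves both tasks: the Bayes rule applied to `u` and the outcome gives the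
estimate, and the outcome is kept for decoding. As the states are unknown, decoding faces the
`θ`-averaged channel, and `exists_random_code` reaches every rate below the mutual information given
`u`. `info_denseChannel` computes it; two-level laws `p u` give the stated formulas. -/

/-! ### Classical random coding with threshold decoding -/

section RandomCoding

open Finset

/-- The sum factors over the coordinates, and every factor other than the one at `w` equals `1`. -/
lemma sum_prod_mul_apply {X I : Type} [Fintype X] [Fintype I] [DecidableEq I]
    {p : X → ℝ} (hp : ∑ x, p x = 1) (w : I) (F : X → ℝ) :
    ∑ xs : I → X, (∏ i, p (xs i)) * F (xs w) = ∑ x, p x * F x := by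
  have h : ∀ xs : I → X, (∏ i, p (xs i)) * F (xs w) =
      ∏ i, (p (xs i) * if i = w then F (xs i) else 1) := by
    intro xs
    rw [prod_mul_distrib, Fintype.prod_ite_eq']
  simp_rw [h]
  rw [← Fintype.prod_sum (fun i x => p x * if i = w then F x else 1)]
  rw [Fintype.prod_eq_single w]
  · simp
  · intro i hi
    simp [hi, hp]

/-- Two distinct codewords are independent; the union bound over wrong messages needs no more than
this pairwise independence. -/
lemma sum_prod_mul_apply₂ {X I : Type} [Fintype X] [Fintype I] [DecidableEq I]
    {p : X → ℝ} (hp : ∑ x, p x = 1) {w v : I} (hwv : w ≠ v) (F G : X → ℝ) :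
    ∑ xs : I → X, (∏ i, p (xs i)) * (F (xs w) * G (xs v)) =
      (∑ x, p x * F x) * ∑ x, p x * G x := by
  have h : ∀ xs : I → X, (∏ i, p (xs i)) * (F (xs w) * G (xs v)) =
      ∏ i, (p (xs i) * ((if i = w then F (xs i) else 1) * if i = v then G (xs i) else 1)) := by
    intro xs
    rw [prod_mul_distrib, prod_mul_distrib, Fintype.prod_ite_eq', Fintype.prod_ite_eq']
  simp_rw [h]
  rw [← Fintype.prod_sum
    (fun i x => p x * ((if i = w then F x else 1) * if i = v then G x else 1))]
  rw [Fintype.prod_eq_mul w v hwv]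
  · simp [hwv, hwv.symm]
  · rintro i ⟨hi, hi'⟩
    simp [hi, hi', hp]

variable {U X Y : Type}

/-- The joint law of the time-sharing symbol, the current symbols of all random codewords and the
channel output, when the codeword of the message `w` is sent. -/
def codeLaw {M : ℕ} (q : U → ℝ) (p : U → X → ℝ) (W : X → Y → ℝ) (w : Fin M)
    (z : U × (Fin M → X) × Y) : ℝ :=
  q z.1 * ((∏ i, p z.1 (z.2.1 i)) * W (z.2.1 w) z.2.2)

lemma codeLaw_nonneg {M : ℕ} {q : U → ℝ} {p : U → X → ℝ} {W : X → Y → ℝ} (hq0 : ∀ u, 0 ≤ q u)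
    (hp0 : ∀ u x, 0 ≤ p u x) (hW0 : ∀ x y, 0 ≤ W x y) (w : Fin M) (z : U × (Fin M → X) × Y) :
    0 ≤ codeLaw q p W w z :=
  mul_nonneg (hq0 _) (mul_nonneg (prod_nonneg fun _ _ => hp0 _ _) (hW0 _ _))

variable [Fintype X]

/-- The law of the channel output given the time-sharing symbol `u`, for the input law `p u`. -/
def outLaw (p : U → X → ℝ) (W : X → Y → ℝ) (u : U) (y : Y) : ℝ := ∑ x, p u x * W x y

lemma outLaw_nonneg {p : U → X → ℝ} {W : X → Y → ℝ} (hp0 : ∀ u x, 0 ≤ p u x)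
    (hW0 : ∀ x y, 0 ≤ W x y) (u : U) (y : Y) : 0 ≤ outLaw p W u y :=
  sum_nonneg fun x _ => mul_nonneg (hp0 u x) (hW0 x y)

/-- Logarithms and likelihood ratios are meaningful only off the zeros of `W` and `outLaw`; outcomes
of probability zero can be discarded. -/
lemma pos_of_codeLaw_pos {M : ℕ} {q : U → ℝ} {p : U → X → ℝ} {W : X → Y → ℝ}
    (hp0 : ∀ u x, 0 ≤ p u x) (hW0 : ∀ x y, 0 ≤ W x y) {w : Fin M} {z : U × (Fin M → X) × Y}
    (hz : codeLaw q p W w z ≠ 0) : 0 < W (z.2.1 w) z.2.2 ∧ 0 < outLaw p W z.1 z.2.2 := by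
  have h1 : W (z.2.1 w) z.2.2 ≠ 0 := by
    intro h; simp [codeLaw, h] at hz
  have h2 : p z.1 (z.2.1 w) ≠ 0 := by
    intro h
    exact hz (by
      simp [codeLaw, prod_eq_zero (f := fun i => p z.1 (z.2.1 i)) (mem_univ w) h])
  have h1' := lt_of_le_of_ne (hW0 _ _) h1.symm
  have h2' := lt_of_le_of_ne (hp0 _ _) h2.symm
  refine ⟨h1', (mul_pos h2' h1').trans_le ?_⟩
  exact single_le_sum (f := fun x => p z.1 x * W x z.2.2)
    (fun x _ => mul_nonneg (hp0 _ _) (hW0 _ _)) (mem_univ _)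

variable [Fintype U] [Fintype Y]

lemma sum_codeLaw_mul {M : ℕ} (q : U → ℝ) {p : U → X → ℝ} (hp : ∀ u, ∑ x, p u x = 1)
    (W : X → Y → ℝ) (w : Fin M) (F : U → X → Y → ℝ) :
    ∑ z, codeLaw q p W w z * F z.1 (z.2.1 w) z.2.2 =
      ∑ u, q u * ∑ x, p u x * ∑ y, W x y * F u x y := by
  rw [Fintype.sum_prod_type]
  refine sum_congr rfl fun u _ => ?_
  rw [← sum_prod_mul_apply (hp u) w, mul_sum, Fintype.sum_prod_type]
  refine sum_congr rfl fun xs _ => ?_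
  rw [mul_sum, mul_sum]
  refine sum_congr rfl fun y _ => ?_
  simp only [codeLaw]
  ring

/-- The mean of the information density, that is, the conditional mutual information given the
time-sharing symbol. -/
noncomputable def meanInfo (q : U → ℝ) (p : U → X → ℝ) (W : X → Y → ℝ) : ℝ :=
  ∑ u, q u * ∑ x, p u x * ∑ y, W x y * (Real.logb 2 (W x y) - Real.logb 2 (outLaw p W u y))

/-- The Chernoff bound on the probability that the sent codeword fails the threshold test. -/
lemma sum_sent_fails_le {M T : ℕ} {q : U → ℝ} {p : U → X → ℝ} {W : X → Y → ℝ} (hq0 : ∀ u, 0 ≤ q u)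
    (hp0 : ∀ u x, 0 ≤ p u x) (hp : ∀ u, ∑ x, p u x = 1) (hW0 : ∀ x y, 0 ≤ W x y)
    (w : Fin M) (r : ℝ) {s : ℝ} (hs : 0 ≤ s) :
    ∑ z : Fin T → U × (Fin M → X) × Y,
      (if ∏ t, ((2 : ℝ) ^ r * outLaw p W (z t).1 (z t).2.2) ≤ ∏ t, W ((z t).2.1 w) (z t).2.2 then 0
        else ∏ t, codeLaw q p W w (z t)) ≤
    (∑ u, q u * ∑ x, p u x * ∑ y, W x y * Real.exp (s * (r * Real.log 2 +
      Real.log (outLaw p W u y) - Real.log (W x y)))) ^ T := by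
  rw [← sum_codeLaw_mul q hp W w (fun u x y => Real.exp (s * (r * Real.log 2 +
      Real.log (outLaw p W u y) - Real.log (W x y)))), ← Fin.prod_const, Fintype.prod_sum]
  refine sum_le_sum fun z _ => ?_
  have hnn : 0 ≤ ∏ t, codeLaw q p W w (z t) := prod_nonneg fun t _ => codeLaw_nonneg hq0 hp0 hW0 _ _
  split_ifs with h
  · exact prod_nonneg fun t _ => mul_nonneg (codeLaw_nonneg hq0 hp0 hW0 _ _) (Real.exp_pos _).le
  · rw [prod_mul_distrib, ← Real.exp_sum]
    by_cases h0 : ∏ t, codeLaw q p W w (z t) = 0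
    · simp [h0]
    have hpos := fun t => pos_of_codeLaw_pos hp0 hW0 (prod_ne_zero_iff.1 h0 t (mem_univ t))
    -- When the test fails, the summed log-likelihood deficit is positive, so its exponential with
    -- `s ≥ 0` dominates the indicator of failure.
    refine le_mul_of_one_le_right hnn (Real.one_le_exp ?_)
    rw [← mul_sum]
    refine mul_nonneg hs ?_
    push Not at h
    have h' := Real.log_le_log (prod_pos fun t _ => (hpos t).1) h.le
    rw [Real.log_prod fun t _ => (hpos t).1.ne', Real.log_prod fun t _ =>
      (mul_pos (by positivity) (hpos t).2).ne'] at h'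
    have h2 : ∀ t, Real.log ((2 : ℝ) ^ r * outLaw p W (z t).1 (z t).2.2) =
        r * Real.log 2 + Real.log (outLaw p W (z t).1 (z t).2.2) := by
      intro t
      rw [Real.log_mul (by positivity) (hpos t).2.ne', Real.log_rpow (by norm_num)]
    simp_rw [h2] at h'
    rw [sum_sub_distrib]
    linarith

/-- The probability that the codeword of another message passes the threshold test. -/
lemma sum_other_passes_le {M T : ℕ} {q : U → ℝ} {p : U → X → ℝ} {W : X → Y → ℝ}
    (hq0 : ∀ u, 0 ≤ q u) (hq : ∑ u, q u = 1)
    (hp0 : ∀ u x, 0 ≤ p u x) (hp : ∀ u, ∑ x, p u x = 1) (hW0 : ∀ x y, 0 ≤ W x y)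
    (hW : ∀ x, ∑ y, W x y = 1) {w v : Fin M} (hwv : w ≠ v) (r : ℝ) :
    ∑ z : Fin T → U × (Fin M → X) × Y,
      (if ∏ t, ((2 : ℝ) ^ r * outLaw p W (z t).1 (z t).2.2) ≤ ∏ t, W ((z t).2.1 v) (z t).2.2 then
        ∏ t, codeLaw q p W w (z t) else 0) ≤ (((2 : ℝ) ^ r)⁻¹) ^ T := by
  -- Markov's inequality for the likelihood ratio: given `u`, the symbol of `v` is independent of
  -- the output, so the single-slot mean of the ratio is at most `2 ^ (-r)`.
  have h2r : (0 : ℝ) ≤ 2 ^ r := by positivity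
  have key : ∑ z : U × (Fin M → X) × Y, codeLaw q p W w z *
      (W (z.2.1 v) z.2.2 / ((2 : ℝ) ^ r * outLaw p W z.1 z.2.2)) ≤ ((2 : ℝ) ^ r)⁻¹ := by
    calc _ = ∑ u, q u * ∑ y, (outLaw p W u y * outLaw p W u y) /
          ((2 : ℝ) ^ r * outLaw p W u y) := by
          rw [Fintype.sum_prod_type]
          refine sum_congr rfl fun u _ => ?_
          rw [Fintype.sum_prod_type, sum_comm, mul_sum]
          refine sum_congr rfl fun y _ => ?_
          unfold outLaw
          rw [← sum_prod_mul_apply₂ (hp u) hwv (fun x => W x y) (fun x => W x y), sum_div, mul_sum]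
          refine sum_congr rfl fun xs _ => ?_
          simp only [codeLaw]
          ring
      _ ≤ ∑ u, q u * ∑ y, outLaw p W u y * ((2 : ℝ) ^ r)⁻¹ := by
          refine sum_le_sum fun u _ => mul_le_mul_of_nonneg_left ?_ (hq0 u)
          refine sum_le_sum fun y _ => ?_
          have hP := outLaw_nonneg hp0 hW0 u y
          rcases hP.eq_or_lt with h | h
          · simp [← h]
          · have h2 : (0 : ℝ) < 2 ^ r := by positivity
            apply le_of_eq
            field_simp
      _ = ((2 : ℝ) ^ r)⁻¹ := by
          simp_rw [← sum_mul]
          have : ∀ u, ∑ y, outLaw p W u y = 1 := by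
            intro u
            unfold outLaw
            rw [sum_comm]
            simp_rw [← mul_sum, hW, mul_one, hp]
          simp_rw [this]
          rw [one_mul, ← sum_mul, hq, one_mul]
  refine le_trans ?_ (pow_le_pow_left₀ (sum_nonneg fun z _ => mul_nonneg
    (codeLaw_nonneg hq0 hp0 hW0 _ _) (div_nonneg (hW0 _ _)
    (mul_nonneg h2r (outLaw_nonneg hp0 hW0 _ _)))) key T)
  rw [← Fin.prod_const, Fintype.prod_sum]
  refine sum_le_sum fun z _ => ?_
  have hnn : 0 ≤ ∏ t, codeLaw q p W w (z t) := prod_nonneg fun t _ => codeLaw_nonneg hq0 hp0 hW0 _ _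
  rw [prod_mul_distrib (f := fun t => codeLaw q p W w (z t))]
  split_ifs with h
  · by_cases h0 : ∏ t, codeLaw q p W w (z t) = 0
    · simp [h0]
    have hpos := fun t => pos_of_codeLaw_pos hp0 hW0 (prod_ne_zero_iff.1 h0 t (mem_univ t))
    refine le_mul_of_one_le_right hnn ?_
    rw [prod_div_distrib]
    rw [one_le_div (prod_pos fun t _ => mul_pos (by positivity) (hpos t).2)]
    exact h
  · exact mul_nonneg hnn (prod_nonneg fun t _ => div_nonneg (hW0 _ _)
      (mul_nonneg h2r (outLaw_nonneg hp0 hW0 _ _)))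

/-- Random coding with threshold decoding, averaged over the code. -/
lemma exists_decoder (M T : ℕ) (hM : 0 < M) {q : U → ℝ} {p : U → X → ℝ} {W : X → Y → ℝ}
    (hq0 : ∀ u, 0 ≤ q u) (hq : ∑ u, q u = 1)
    (hp0 : ∀ u x, 0 ≤ p u x) (hp : ∀ u, ∑ x, p u x = 1) (hW0 : ∀ x y, 0 ≤ W x y)
    (hW : ∀ x, ∑ y, W x y = 1) (r : ℝ) {s : ℝ} (hs : 0 ≤ s) :
    ∃ dec : (Fin T → U × (Fin M → X) × Y) → Fin M, ∀ w,
      ∑ z, (if dec z = w then 0 else ∏ t, codeLaw q p W w (z t)) ≤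
      (∑ u, q u * ∑ x, p u x * ∑ y, W x y * Real.exp (s * (r * Real.log 2 +
        Real.log (outLaw p W u y) - Real.log (W x y)))) ^ T +
      ((M : ℝ) - 1) * (((2 : ℝ) ^ r)⁻¹) ^ T := by
  classical
  let test (w : Fin M) (z : Fin T → U × (Fin M → X) × Y) : Prop :=
    ∏ t, ((2 : ℝ) ^ r * outLaw p W (z t).1 (z t).2.2) ≤ ∏ t, W ((z t).2.1 w) (z t).2.2
  -- Any message passing the test is decoded, with message `0` as default. An error then requires
  -- that the sent codeword fails or that a wrong one passes.
  refine ⟨fun z => if h : ∃ w, test w z then h.choose else ⟨0, hM⟩, fun w => ?_⟩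
  calc _ ≤ ∑ z, ((if test w z then 0 else ∏ t, codeLaw q p W w (z t)) +
        ∑ v ∈ univ.erase w, if test v z then ∏ t, codeLaw q p W w (z t) else 0) := by
        refine sum_le_sum fun z _ => ?_
        have hnn : 0 ≤ ∏ t, codeLaw q p W w (z t) :=
          prod_nonneg fun t _ => codeLaw_nonneg hq0 hp0 hW0 _ _
        have hnn' : ∀ v ∈ univ.erase w,
            0 ≤ if test v z then ∏ t, codeLaw q p W w (z t) else 0 := by
          intro v _; split_ifs <;> simp [hnn]
        have hs0 := sum_nonneg hnn'
        split_ifs with h1 h2 h2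
        · simpa using hs0
        · exact add_nonneg hnn hs0
        · have hex : ∃ w, test w z := ⟨w, h2⟩
          simp only [dif_pos hex] at h1
          rw [zero_add]
          refine le_trans ?_ (single_le_sum hnn' (mem_erase.2 ⟨h1, mem_univ _⟩))
          rw [if_pos hex.choose_spec]
        · linarith
    _ ≤ _ := by
        rw [sum_add_distrib, sum_comm]
        refine add_le_add (sum_sent_fails_le hq0 hp0 hp hW0 w r hs) ?_
        refine (sum_le_card_nsmul _ _ _ fun v hv =>
          sum_other_passes_le hq0 hq hp0 hp hW0 hW (ne_of_mem_erase hv).symm r).trans ?_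
        rw [card_erase_of_mem (mem_univ w), card_univ, Fintype.card_fin, nsmul_eq_mul,
          Nat.cast_sub hM, Nat.cast_one]

/-- Below the mean information density, the Chernoff exponent is positive. -/
lemma exists_chernoff_lt_one {q : U → ℝ} {p : U → X → ℝ} {W : X → Y → ℝ}
    (hq : ∑ u, q u = 1) (hp : ∀ u, ∑ x, p u x = 1)
    (hW : ∀ x, ∑ y, W x y = 1) {r : ℝ} (hr : r < meanInfo q p W) :
    ∃ s : ℝ, 0 ≤ s ∧ ∑ u, q u * ∑ x, p u x * ∑ y, W x y * Real.exp (s * (r * Real.log 2 +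
        Real.log (outLaw p W u y) - Real.log (W x y))) < 1 := by
  set φ : ℝ → ℝ := fun s => ∑ u, q u * ∑ x, p u x * ∑ y, W x y * Real.exp (s * (r * Real.log 2 +
        Real.log (outLaw p W u y) - Real.log (W x y))) with hφ
  have hone : ∀ c : ℝ, ∑ u, q u * ∑ x, p u x * ∑ y, W x y * c = c := by
    intro c
    simp_rw [← sum_mul, hW, one_mul, ← sum_mul, hp, one_mul, ← sum_mul, hq, one_mul]
  have h0 : φ 0 = 1 := by
    simp only [hφ, zero_mul, Real.exp_zero]
    exact hone 1
  have hd : HasDerivAt φ (∑ u, q u * ∑ x, p u x * ∑ y, W x y * (r * Real.log 2 +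
        Real.log (outLaw p W u y) - Real.log (W x y))) 0 := by
    refine HasDerivAt.fun_sum fun u _ => HasDerivAt.const_mul _ (HasDerivAt.fun_sum fun x _ =>
      HasDerivAt.const_mul _ (HasDerivAt.fun_sum fun y _ => HasDerivAt.const_mul _ ?_))
    have := ((hasDerivAt_id (0 : ℝ)).mul_const (r * Real.log 2 +
        Real.log (outLaw p W u y) - Real.log (W x y))).exp
    simpa using this
  have hl2 : 0 < Real.log 2 := Real.log_pos (by norm_num)
  have hneg : (∑ u, q u * ∑ x, p u x * ∑ y, W x y * (r * Real.log 2 +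
        Real.log (outLaw p W u y) - Real.log (W x y))) < 0 := by
    -- The derivative at `0` is the gap between `r` and the mean information density, converted from
    -- bits to nats.
    have : (∑ u, q u * ∑ x, p u x * ∑ y, W x y * (r * Real.log 2 +
        Real.log (outLaw p W u y) - Real.log (W x y))) =
        (r - meanInfo q p W) * Real.log 2 := by
      conv_rhs => rw [← hone r]
      unfold meanInfo
      simp only [← sum_sub_distrib, sum_mul, ← mul_sub]
      refine sum_congr rfl fun u _ => ?_
      rw [mul_assoc, sum_mul]
      congr 1
      refine sum_congr rfl fun x _ => ?_
      rw [mul_assoc, sum_mul]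
      congr 1
      refine sum_congr rfl fun y _ => ?_
      rw [Real.logb, Real.logb]
      field_simp
      ring
    -- A negative derivative together with `φ 0 = 1` gives `φ s < 1` for some small `s > 0`.
    rw [this]
    exact mul_neg_of_neg_of_pos (by linarith) hl2
  have hev := (hasDerivWithinAt_iff_tendsto_slope' (s := Set.Ioi 0) (by simp)).1
    hd.hasDerivWithinAt |>.eventually (gt_mem_nhds hneg)
  obtain ⟨s, hs, hs0⟩ := (hev.and self_mem_nhdsWithin).exists
  have hs0 : 0 < s := hs0
  refine ⟨s, hs0.le, ?_⟩
  rw [slope_def_field, h0, sub_zero, div_neg_iff] at hs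
  rcases hs with h | h
  · linarith
  · linarith [h.1]

/-- The channel coding theorem with common randomness: all rates below the mean information density
are achievable, with the error probability of every message averaged over a random code whose
symbols are drawn independently in time. -/
theorem exists_random_code {q : U → ℝ} {p : U → X → ℝ} {W : X → Y → ℝ}
    (hq0 : ∀ u, 0 ≤ q u) (hq : ∑ u, q u = 1)
    (hp0 : ∀ u x, 0 ≤ p u x) (hp : ∀ u, ∑ x, p u x = 1) (hW0 : ∀ x y, 0 ≤ W x y)
    (hW : ∀ x, ∑ y, W x y = 1) {R ε : ℝ} (hR : R < meanInfo q p W) (hε : 0 < ε) :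
    ∃ M T : ℕ, 0 < M ∧ 0 < T ∧ R ≤ Real.logb 2 M / T ∧
      ∃ dec : (Fin T → U × (Fin M → X) × Y) → Fin M, ∀ w,
        ∑ z, (if dec z = w then 0 else ∏ t, codeLaw q p W w (z t)) ≤ ε := by
  -- The threshold `r` leaves room on both sides: `r` below the mean makes `φ ^ T` decay, and `R <
  -- r` makes the union bound `2 ^ ((R - r) * T)` decay.
  obtain ⟨r, hRr, hr⟩ := exists_between hR
  obtain ⟨s, hs, hφ⟩ := exists_chernoff_lt_one hq hp hW hr
  set φ := ∑ u, q u * ∑ x, p u x * ∑ y, W x y * Real.exp (s * (r * Real.log 2 +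
        Real.log (outLaw p W u y) - Real.log (W x y)))
  have hφ0 : 0 ≤ φ := sum_nonneg fun u _ => mul_nonneg (hq0 u) <| sum_nonneg fun x _ =>
    mul_nonneg (hp0 u x) <| sum_nonneg fun y _ => mul_nonneg (hW0 x y) (Real.exp_pos _).le
  have h1 := tendsto_pow_atTop_nhds_zero_of_lt_one hφ0 hφ
  have hb : (2 : ℝ) ^ (R - r) < 1 := Real.rpow_lt_one_of_one_lt_of_neg (by norm_num) (by linarith)
  have h2 := tendsto_pow_atTop_nhds_zero_of_lt_one (by positivity) hb
  have h3 := h1.add h2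
  rw [add_zero] at h3
  obtain ⟨T, hT, hT0⟩ := ((h3.eventually (gt_mem_nhds hε)).and (Filter.eventually_gt_atTop 0)).exists
  have hTr : (0 : ℝ) < T := by exact_mod_cast hT0
  have hpos : (0 : ℝ) < (2 : ℝ) ^ (R * T) := by positivity
  -- Rounding up secures the rate, while the number `M - 1` of wrong messages stays at most `2 ^ (R
  -- * T)`.
  refine ⟨⌈(2 : ℝ) ^ (R * T)⌉₊, T, Nat.ceil_pos.2 hpos, hT0, ?_, ?_⟩
  · rw [le_div_iff₀ hTr, Real.le_logb_iff_rpow_le (by norm_num)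
      (by exact_mod_cast Nat.ceil_pos.2 hpos)]
    exact Nat.le_ceil _
  · obtain ⟨dec, hdec⟩ := exists_decoder ⌈(2 : ℝ) ^ (R * T)⌉₊ T (Nat.ceil_pos.2 hpos) hq0 hq hp0 hp
      hW0 hW r hs
    refine ⟨dec, fun w => (hdec w).trans (le_trans ?_ hT.le)⟩
    refine add_le_add le_rfl ?_
    have hc : ((⌈(2 : ℝ) ^ (R * T)⌉₊ : ℝ) - 1) ≤ (2 : ℝ) ^ (R * T) := by
      linarith [Nat.ceil_lt_add_one hpos.le]
    calc _ ≤ (2 : ℝ) ^ (R * T) * (((2 : ℝ) ^ r)⁻¹) ^ T :=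
          mul_le_mul_of_nonneg_right hc (by positivity)
      _ = _ := by
          rw [Real.rpow_mul (by norm_num), Real.rpow_natCast, ← mul_pow, Real.rpow_sub (by norm_num),
            div_eq_mul_inv]

end RandomCoding

/-! ### Kraus maps and product operators -/

section QuantumMaps

open Finset Matrix

variable {ι κ ν : Type}

lemma tensorId_apply (Φ : Op ι →ₗ[ℂ] Op κ) (X : Op (ι × ν)) (k l : κ × ν) :
    tensorId Φ ν X k l = Φ (Matrix.of fun i j => X (i, k.2) (j, l.2)) k.1 l.1 := rfl

/-- The completely positive map with Kraus operators `K`. -/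
def krausMap {J : Type} [Fintype J] [Fintype ι] (K : J → Matrix κ ι ℂ) : Op ι →ₗ[ℂ] Op κ where
  toFun X := ∑ j, K j * X * (K j)ᴴ
  map_add' X Y := by simp [Matrix.mul_add, Matrix.add_mul, sum_add_distrib]
  map_smul' c X := by simp [smul_sum]

lemma krausMap_apply {J : Type} [Fintype J] [Fintype ι] (K : J → Matrix κ ι ℂ) (X : Op ι) :
    krausMap K X = ∑ j, K j * X * (K j)ᴴ := rfl

/-- The extended map has the Kraus operators `K j ⊗ 1`, which makes complete positivity evident. -/
lemma tensorId_krausMap {J : Type} [Fintype J] [Fintype ι] [Fintype ν] [DecidableEq ν]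
    (K : J → Matrix κ ι ℂ) (X : Op (ι × ν)) :
    tensorId (krausMap K) ν X =
      ∑ j, (Matrix.of fun (k : κ × ν) (i : ι × ν) => if k.2 = i.2 then K j k.1 i.1 else 0) * X *
        (Matrix.of fun (k : κ × ν) (i : ι × ν) => if k.2 = i.2 then K j k.1 i.1 else 0)ᴴ := by
  ext k l
  rw [tensorId_apply, krausMap_apply, Matrix.sum_apply, Matrix.sum_apply]
  refine sum_congr rfl fun j _ => ?_
  simp only [Matrix.mul_apply, Matrix.conjTranspose_apply, Matrix.of_apply, Fintype.sum_prod_type,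
    apply_ite star, star_zero, mul_ite, ite_mul, zero_mul, mul_zero, sum_ite_eq, mem_univ, if_true]

lemma isCompletelyPositive_krausMap {J : Type} [Fintype J] [Fintype ι] [Fintype κ]
    (K : J → Matrix κ ι ℂ) : IsCompletelyPositive (krausMap K) := by
  intro n X hX
  rw [tensorId_krausMap]
  exact Matrix.posSemidef_sum _ fun j _ => hX.mul_mul_conjTranspose_same _

lemma isTracePreserving_krausMap {J : Type} [Fintype J] [Fintype ι] [Fintype κ] [DecidableEq ι]
    {K : J → Matrix κ ι ℂ} (hK : ∑ j, (K j)ᴴ * K j = 1) : IsTracePreserving (krausMap K) := by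
  intro X
  rw [krausMap_apply, Matrix.trace_sum]
  have : ∀ j, (K j * X * (K j)ᴴ).trace = ((K j)ᴴ * K j * X).trace := by
    intro j
    rw [Matrix.trace_mul_comm, Matrix.mul_assoc]
  simp_rw [this]
  rw [← Matrix.trace_sum, ← Matrix.sum_mul, hK, Matrix.one_mul]

lemma IsTracePreserving.tensorId [Fintype ι] [Fintype κ] [Fintype ν] {Φ : Op ι →ₗ[ℂ] Op κ}
    (hΦ : IsTracePreserving Φ) : IsTracePreserving (tensorId Φ ν) := by
  intro X
  have h := fun y : ν => hΦ (Matrix.of fun i j => X (i, y) (j, y))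
  simp only [Matrix.trace, Matrix.diag_apply, Fintype.sum_prod_type_right, tensorId_apply] at h ⊢
  exact sum_congr rfl fun y _ => h y

variable {T : ℕ}

/-- The tensor product of the operators `X t`. -/
def tensorOp (X : Fin T → Op ι) : Op (Fin T → ι) := Matrix.of fun i j => ∏ t, X t (i t) (j t)

lemma tensorOp_apply (X : Fin T → Op ι) (i j : Fin T → ι) :
    tensorOp X i j = ∏ t, X t (i t) (j t) := rfl

lemma trace_tensorOp [Fintype ι] (X : Fin T → Op ι) :
    (tensorOp X).trace = ∏ t, (X t).trace := by
  simp only [Matrix.trace, Matrix.diag_apply, tensorOp_apply]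
  rw [Fintype.prod_sum]

lemma tensorOp_mul [Fintype ι] (X Y : Fin T → Op ι) :
    tensorOp X * tensorOp Y = tensorOp fun t => X t * Y t := by
  ext i j
  simp only [Matrix.mul_apply, tensorOp_apply]
  rw [Fintype.prod_sum]
  simp_rw [prod_mul_distrib]

lemma tensorOp_conjTranspose (X : Fin T → Op ι) :
    (tensorOp X)ᴴ = tensorOp fun t => (X t)ᴴ := by
  ext i j
  simp [tensorOp_apply, Matrix.conjTranspose_apply]

/-- Factoring each `X t` as `Bᴴ * B` factors the tensor product in the same way. -/
lemma posSemidef_tensorOp [Fintype ι] {X : Fin T → Op ι} (hX : ∀ t, (X t).PosSemidef) :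
    (tensorOp X).PosSemidef := by
  classical
  have h : ∀ t, ∃ B : Op ι, X t = Bᴴ * B := fun t => by
    open scoped MatrixOrder in
    exact CStarAlgebra.nonneg_iff_eq_star_mul_self.mp (hX t).nonneg
  choose B hB using h
  rw [show X = fun t => (B t)ᴴ * B t from funext hB, ← tensorOp_mul, ← tensorOp_conjTranspose]
  exact Matrix.posSemidef_conjTranspose_mul_self _

lemma isDensity_tensorOp [Fintype ι] {X : Fin T → Op ι} (hX : ∀ t, IsDensity (X t)) :
    IsDensity (tensorOp X) :=
  ⟨posSemidef_tensorOp fun t => (hX t).1, by simp [trace_tensorOp, (hX _).2]⟩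

lemma sum_mul_map_single [Fintype ι] [DecidableEq ι] (Φ : Op ι →ₗ[ℂ] Op κ) (X : Op ι) (k l : κ) :
    ∑ i, ∑ j, X i j * Φ (Matrix.single i j 1) k l = Φ X k l := by
  conv_rhs => rw [Matrix.matrix_eq_sum_single X, map_sum]
  rw [Matrix.sum_apply]
  refine sum_congr rfl fun i _ => ?_
  rw [map_sum, Matrix.sum_apply]
  refine sum_congr rfl fun j _ => ?_
  rw [show Matrix.single i j (X i j) = X i j • Matrix.single i j (1 : ℂ) by
    rw [Matrix.smul_single, smul_eq_mul, mul_one], map_smul, Matrix.smul_apply, smul_eq_mul]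

/-- Product states stay product states, so the whole protocol is analysed slot by slot. After
expansion in matrix units, the sum over multi-indices factors over `t`. -/
lemma tensorMaps_tensorOp [Fintype ι] [DecidableEq ι] (Φ : Fin T → (Op ι →ₗ[ℂ] Op κ))
    (X : Fin T → Op ι) : tensorMaps Φ (tensorOp X) = tensorOp fun t => Φ t (X t) := by
  ext k l
  simp only [tensorMaps, Matrix.of_apply, tensorOp_apply]
  simp_rw [← sum_mul_map_single (Φ _) (X _)]
  rw [Fintype.prod_sum]
  refine sum_congr rfl fun i _ => ?_
  rw [Fintype.prod_sum]
  refine sum_congr rfl fun j _ => ?_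
  rw [prod_mul_distrib]

lemma tensorMaps_smul [Fintype ι] [DecidableEq ι] (Φ : Fin T → (Op ι →ₗ[ℂ] Op κ)) (c : ℂ)
    (X : Op (Fin T → ι)) : tensorMaps Φ (c • X) = c • tensorMaps Φ X := by
  ext k l
  simp only [tensorMaps, Matrix.of_apply, Matrix.smul_apply, smul_eq_mul, mul_sum, mul_assoc]

lemma tensorMaps_sum [Fintype ι] [DecidableEq ι] {J : Type} [Fintype J]
    (Φ : Fin T → (Op ι →ₗ[ℂ] Op κ)) (X : J → Op (Fin T → ι)) :
    tensorMaps Φ (∑ m, X m) = ∑ m, tensorMaps Φ (X m) := by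
  ext k l
  simp only [tensorMaps, Matrix.of_apply, Matrix.sum_apply, sum_mul]
  simp_rw [← sum_comm (s := (univ : Finset J))]

lemma reduceTo_smul [Fintype ι] [DecidableEq ι] (t : Fin T) (c : ℂ) (X : Op (Fin T → ι)) :
    reduceTo t (c • X) = c • reduceTo t X := by
  ext k l
  simp only [reduceTo, Matrix.of_apply, Matrix.smul_apply, smul_eq_mul, mul_sum, mul_ite, mul_zero]

lemma reduceTo_sum [Fintype ι] [DecidableEq ι] {J : Type} [Fintype J]
    (t : Fin T) (X : J → Op (Fin T → ι)) :
    reduceTo t (∑ m, X m) = ∑ m, reduceTo t (X m) := by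
  ext k l
  simp only [reduceTo, Matrix.of_apply, Matrix.sum_apply]
  rw [sum_comm]
  refine sum_congr rfl fun i _ => ?_
  split_ifs <;> simp

lemma reduceTo_tensorOp [Fintype ι] [DecidableEq ι] (t : Fin T) {X : Fin T → Op ι}
    (hX : ∀ t' ≠ t, (X t').trace = 1) : reduceTo t (tensorOp X) = X t := by
  ext i j
  simp only [reduceTo, Matrix.of_apply, tensorOp_apply]
  -- The condition on slot `t` is absorbed into its own factor, so that the summand is a product
  -- over slots and the sum factors.
  have h : ∀ f : Fin T → ι,
      (if f t = i then ∏ t', X t' (f t') (Function.update f t j t') else 0) =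
      ∏ t', if t' = t then (if f t' = i then X t' (f t') j else 0) else X t' (f t') (f t') := by
    intro f
    split_ifs with hf
    · refine prod_congr rfl fun t' _ => ?_
      by_cases ht : t' = t
      · subst ht; simp [hf]
      · simp [ht]
    · rw [prod_eq_zero (mem_univ t)]
      simp [hf]
  simp_rw [h]
  rw [← Fintype.prod_sum (fun t' (a : ι) =>
    if t' = t then (if a = i then X t' a j else 0) else X t' a a), Fintype.prod_eq_single t]
  · simp
  · intro t' ht
    simpa [ht, Matrix.trace] using hX t' ht

end QuantumMaps

/-! ### Shift and phase operators -/

section Weyl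

open Finset Matrix

/-- There is an orthogonal basis of `d ^ 2` unitary operators. -/
theorem exists_unitary_basis (d : ℕ) (hd : 0 < d) :
    ∃ V : Fin (d ^ 2) → Op (Fin d), (∀ x, (V x)ᴴ * V x = 1) ∧
      ∀ x y, ((V x)ᴴ * V y).trace = if x = y then (d : ℂ) else 0 := by
  have : NeZero d := ⟨hd.ne'⟩
  let e : Fin d ≃ ZMod d := Fintype.equivOfCardEq (by simp [ZMod.card])
  let g : Fin (d ^ 2) ≃ ZMod d × ZMod d := Fintype.equivOfCardEq (by simp [ZMod.card, sq])
  let χ : AddChar (ZMod d) ℂ := ZMod.stdAddChar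
  have hχ : ∀ a, star (χ a) = χ (-a) := fun a => by
    rw [AddChar.map_neg_eq_conj]; rfl
  -- These are the entries of `(V x)ᴴ * V y`: only the shifted index `e i + x.1` contributes.
  have htr : ∀ x y : ZMod d × ZMod d, ∀ i j : Fin d,
      ∑ k : Fin d, star (if e k = e i + x.1 then χ (e i * x.2) else 0) *
        (if e k = e j + y.1 then χ (e j * y.2) else 0) =
      if e i + x.1 = e j + y.1 then χ (e j * y.2 - e i * x.2) else 0 := by
    intro x y i j
    rw [e.sum_comp (fun k => star (if k = e i + x.1 then χ (e i * x.2) else 0) *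
        (if k = e j + y.1 then χ (e j * y.2) else 0)), Fintype.sum_eq_single (e i + x.1)]
    · rw [if_pos rfl, hχ]
      split_ifs
      · rw [← AddChar.map_add_eq_mul]; ring_nf
      · simp
    · intro k hk; simp [hk]
  -- The operator with index `(a, b)` multiplies the basis vector `i` by the phase `χ (i * b)` and
  -- shifts it to `i + a`.
  refine ⟨fun x => Matrix.of fun k i => if e k = e i + (g x).1 then χ (e i * (g x).2) else 0,
    fun x => ?_, fun x y => ?_⟩
  · ext i j
    simp only [Matrix.mul_apply, Matrix.conjTranspose_apply, Matrix.of_apply, htr]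
    by_cases h : i = j
    · subst h; simp
    · simp [h]
  · simp only [Matrix.trace, Matrix.diag_apply, Matrix.mul_apply, Matrix.conjTranspose_apply,
      Matrix.of_apply, htr]
    rw [e.sum_comp (fun a : ZMod d => if a + (g x).1 = a + (g y).1 then
      χ (a * (g y).2 - a * (g x).2) else 0)]
    simp only [add_right_inj, ← mul_sub]
    by_cases h1 : (g x).1 = (g y).1
    · simp only [h1, if_true]
      -- For equal shifts the trace is a character sum, which vanishes for different phases because
      -- `χ` is primitive.
      rw [AddChar.sum_mulShift _ (ZMod.isPrimitive_stdAddChar d)]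
      have : x = y ↔ (g y).2 - (g x).2 = 0 := by
        rw [← g.injective.eq_iff, Prod.ext_iff, sub_eq_zero]
        simp [h1, eq_comm]
      simp [this, ZMod.card]
    · have : x ≠ y := by rintro rfl; exact h1 rfl
      simp [h1, this]

end Weyl

/-! ### Change of index types, to pass to the bases `Fin n` of a protocol -/

section Relabel

open Finset Matrix

variable {ι κ ι' κ' ν ν' : Type}

/-- A map on operators with relabelled bases of the input space and of the output space. -/
def relabel (e : ι' ≃ ι) (f : κ' ≃ κ) (Φ : Op ι →ₗ[ℂ] Op κ) : Op ι' →ₗ[ℂ] Op κ' where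
  toFun X := (Φ (X.submatrix e.symm e.symm)).submatrix f f
  map_add' X Y := by
    rw [show (X + Y).submatrix e.symm e.symm = X.submatrix e.symm e.symm +
      Y.submatrix e.symm e.symm from rfl, map_add]
    rfl
  map_smul' c X := by
    rw [show (c • X).submatrix e.symm e.symm = c • X.submatrix e.symm e.symm from rfl, map_smul]
    rfl

lemma relabel_apply (e : ι' ≃ ι) (f : κ' ≃ κ) (Φ : Op ι →ₗ[ℂ] Op κ) (X : Op ι') :
    relabel e f Φ X = (Φ (X.submatrix e.symm e.symm)).submatrix f f := rfl

lemma relabel_submatrix (e : ι' ≃ ι) (f : κ' ≃ κ) (Φ : Op ι →ₗ[ℂ] Op κ) (X : Op ι) :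
    relabel e f Φ (X.submatrix e e) = (Φ X).submatrix f f := by
  simp [relabel_apply]

lemma IsCompletelyPositive.relabel {Φ : Op ι →ₗ[ℂ] Op κ} (hΦ : IsCompletelyPositive Φ)
    (e : ι' ≃ ι) (f : κ' ≃ κ) : IsCompletelyPositive (relabel e f Φ) := by
  intro n X hX
  exact (hΦ n _ (hX.submatrix (Prod.map e.symm id))).submatrix (Prod.map f id)

lemma trace_submatrix_equiv [Fintype ι] [Fintype ι'] (e : ι' ≃ ι) (X : Op ι) :
    (X.submatrix e e).trace = X.trace :=
  e.sum_comp (fun i => X i i)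

lemma IsTracePreserving.relabel [Fintype ι] [Fintype κ] [Fintype ι'] [Fintype κ']
    {Φ : Op ι →ₗ[ℂ] Op κ} (hΦ : IsTracePreserving Φ)
    (e : ι' ≃ ι) (f : κ' ≃ κ) : IsTracePreserving (relabel e f Φ) := by
  intro X
  rw [relabel_apply, trace_submatrix_equiv, hΦ, trace_submatrix_equiv]

lemma relabel_sum {J : Type} [Fintype J] (e : ι' ≃ ι) (f : κ' ≃ κ)
    (Φ : J → (Op ι →ₗ[ℂ] Op κ)) : relabel e f (∑ j, Φ j) = ∑ j, relabel e f (Φ j) := by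
  ext X k l
  simp [relabel_apply, LinearMap.sum_apply, Matrix.sum_apply]

lemma tensorId_relabel_submatrix (e : ι' ≃ ι) (f : κ' ≃ κ) (g : ν' ≃ ν) (Φ : Op ι →ₗ[ℂ] Op κ)
    (X : Op (ι × ν)) :
    tensorId (relabel e f Φ) ν' (X.submatrix (Equiv.prodCongr e g) (Equiv.prodCongr e g)) =
      (tensorId Φ ν X).submatrix (Equiv.prodCongr f g) (Equiv.prodCongr f g) := by
  ext k l
  refine congrArg (fun Y => Φ Y (f k.1) (f l.1)) ?_
  ext i j
  simp

end Relabel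

/-! ### Protocols that act identically and independently in every slot -/

section ProductProtocol

open Finset Matrix

variable {d : ℕ} {κ A B Q : Type} [Fintype κ] [Fintype A] [Fintype B] [Fintype Q]

/-- The protocol that shares the state `ρ` in every slot, encodes by the same map in every
slot, and decodes classically from the diagonal of the remaining systems. -/
noncomputable def productProtocol {M T : ℕ} (hM : 0 < M) (hT : 0 < T)
    {ρ : Op (A × B)} (hρ : IsDensity ρ) {enc : Fin M → (Op A →ₗ[ℂ] Op (Fin d))}
    (henc : ∀ w, IsCompletelyPositive (enc w)) (henc' : ∀ w, IsTracePreserving (enc w))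
    {inst : Fin 2 → (Op (κ × B) →ₗ[ℂ] Op Q)} (hinst : ∀ s, IsCompletelyPositive (inst s))
    (hinst' : IsTracePreserving (∑ s, inst s)) (dec : (Fin T → Q) → Fin M) :
    JCIDProtocol d κ where
  M := M
  T := T
  M_pos := hM
  T_pos := hT
  a := Fintype.card A
  b := Fintype.card B
  q := Fintype.card Q
  ρ := tensorOp fun _ => ρ.submatrix
    (Equiv.prodCongr (Fintype.equivFin A).symm (Fintype.equivFin B).symm)
    (Equiv.prodCongr (Fintype.equivFin A).symm (Fintype.equivFin B).symm)
  ρ_density := isDensity_tensorOp fun _ =>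
    ⟨hρ.1.submatrix _, by rw [trace_submatrix_equiv, hρ.2]⟩
  enc w _ := relabel (Fintype.equivFin A).symm (Equiv.refl _) (enc w)
  enc_cp w _ := (henc w).relabel _ _
  enc_tp w _ := (henc' w).relabel _ _
  inst s := relabel (Equiv.prodCongr (Equiv.refl κ) (Fintype.equivFin B).symm)
    (Fintype.equivFin Q).symm (inst s)
  inst_cp s := (hinst s).relabel _ _
  inst_tp := by
    rw [← relabel_sum]
    exact hinst'.relabel _ _
  -- The estimates `k.1` are ignored.
  povm w := Matrix.diagonal fun k => if dec (fun t => (Fintype.equivFin Q).symm (k.2 t)) = w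
    then 1 else 0
  povm_pos w := by
    refine Matrix.PosSemidef.diagonal fun k => ?_
    dsimp only
    split_ifs <;> simp
  povm_sum := by
    ext k l
    rw [Matrix.sum_apply]
    by_cases h : k = l
    · subst h; simp
    · simp [h]

variable {M T : ℕ} (hM : 0 < M) (hT : 0 < T)
    {ρ : Op (A × B)} (hρ : IsDensity ρ) {enc : Fin M → (Op A →ₗ[ℂ] Op (Fin d))}
    (henc : ∀ w, IsCompletelyPositive (enc w)) (henc' : ∀ w, IsTracePreserving (enc w))
    {inst : Fin 2 → (Op (κ × B) →ₗ[ℂ] Op Q)} (hinst : ∀ s, IsCompletelyPositive (inst s))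
    (hinst' : IsTracePreserving (∑ s, inst s)) (dec : (Fin T → Q) → Fin M)

lemma productProtocol_encoded (w : Fin M) :
    (productProtocol hM hT hρ henc henc' hinst hinst' dec).encoded w =
      tensorOp fun _ => (tensorId (enc w) B ρ).submatrix
        (Equiv.prodCongr (Equiv.refl _) (Fintype.equivFin B).symm)
        (Equiv.prodCongr (Equiv.refl _) (Fintype.equivFin B).symm) := by
  unfold JCIDProtocol.encoded
  refine (tensorMaps_tensorOp _ _).trans ?_
  congr 1
  funext t
  exact tensorId_relabel_submatrix _ _ _ _ _

lemma productProtocol_transmit_encoded (C : Fin T → (Op (Fin d) →ₗ[ℂ] Op κ)) (w : Fin M) :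
    (productProtocol hM hT hρ henc henc' hinst hinst' dec).transmit C
      ((productProtocol hM hT hρ henc henc' hinst hinst' dec).encoded w) =
      tensorOp fun t => (tensorId (C t) B (tensorId (enc w) B ρ)).submatrix
        (Equiv.prodCongr (Equiv.refl _) (Fintype.equivFin B).symm)
        (Equiv.prodCongr (Equiv.refl _) (Fintype.equivFin B).symm) := by
  rw [productProtocol_encoded]
  exact tensorMaps_tensorOp _ _

/-- Decoding ignores the estimates, so summing over them replaces each instrument branch by the full
map `∑ s, Φ s`. -/
lemma trace_decode_tensorOp {ι ξ : Type} [Fintype ι] [DecidableEq ι] [Fintype ξ] [DecidableEq ξ]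
    (Φ : Fin 2 → (Op ι →ₗ[ℂ] Op ξ)) (X : Fin T → Op ι) (D : (Fin T → ξ) → Prop) [DecidablePred D] :
    (Matrix.diagonal (fun k : (Fin T → Fin 2) × (Fin T → ξ) => if D k.2 then (1 : ℂ) else 0) *
      Matrix.of fun k l : (Fin T → Fin 2) × (Fin T → ξ) =>
        if k.1 = l.1 then tensorMaps (fun t => Φ (k.1 t)) (tensorOp X) k.2 l.2 else 0).trace =
      ∑ z, if D z then ∏ t, (∑ s, Φ s) (X t) (z t) (z t) else 0 := by
  simp only [Matrix.trace, Matrix.diag_apply, Matrix.diagonal_mul, Matrix.of_apply, if_true,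
    tensorMaps_tensorOp, tensorOp_apply, Fintype.sum_prod_type_right]
  refine sum_congr rfl fun z _ => ?_
  split_ifs with h
  · simp only [one_mul, LinearMap.sum_apply, Matrix.sum_apply]
    rw [Fintype.prod_sum]
  · simp

lemma re_trace_map_smul_sum {ι ξ J : Type} [Fintype ξ] [Fintype J] (Φ : Op ι →ₗ[ℂ] Op ξ)
    (c : ℝ) (X : J → Op ι) :
    (Φ ((c : ℂ) • ∑ j, X j)).trace.re = c * ∑ j, (Φ (X j)).trace.re := by
  rw [map_smul, map_sum, Matrix.trace_smul, Matrix.trace_sum, smul_eq_mul, Complex.re_ofReal_mul,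
    Complex.re_sum]

lemma productProtocol_decodeProb [DecidableEq κ] (θ : Fin 2 → ℝ) (N : Fin 2 → (Op (Fin d) →ₗ[ℂ] Op κ))
    (w w' : Fin M) :
    (productProtocol hM hT hρ henc henc' hinst hinst' dec).decodeProb θ N w w' =
      (∑ z : Fin T → Q, if dec z = w' then ∏ t, (∑ s, inst s)
        (tensorId (JCIDProtocol.overall θ N) B (tensorId (enc w) B ρ)) (z t) (z t) else 0).re := by
  unfold JCIDProtocol.decodeProb
  refine (congrArg (fun X => Complex.re (Matrix.trace
    ((productProtocol hM hT hρ henc henc' hinst hinst' dec).povm w' *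
      (productProtocol hM hT hρ henc henc' hinst hinst' dec).afterDetection X)))
    (productProtocol_transmit_encoded hM hT hρ henc henc' hinst hinst' dec _ w)).trans ?_
  refine congrArg Complex.re ((trace_decode_tensorOp _ _ (fun z =>
    dec (fun t => (Fintype.equivFin Q).symm (z t)) = w')).trans ?_)
  refine Fintype.sum_equiv (Equiv.arrowCongr (Equiv.refl (Fin T)) (Fintype.equivFin Q).symm)
    _ _ fun z => ?_
  refine if_congr Iff.rfl (prod_congr rfl fun t _ => ?_) rfl
  exact congrFun (congrFun ((LinearMap.congr_fun (relabel_sum _ _ _).symm _).trans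
    (relabel_submatrix _ _ _ _)) _) _

/-- Encoders and the overall channel preserve the trace, so all other slots are traced out; the
value is the same in every slot. -/
lemma productProtocol_detectProb [DecidableEq κ] {θ : Fin 2 → ℝ} {N : Fin 2 → (Op (Fin d) →ₗ[ℂ] Op κ)}
    (hN : IsTracePreserving (JCIDProtocol.overall θ N)) (t : Fin T) (s s' : Fin 2) :
    (productProtocol hM hT hρ henc henc' hinst hinst' dec).detectProb θ N t s s' =
      (M : ℝ)⁻¹ * ∑ w, (inst s' (tensorId (N s) B (tensorId (enc w) B ρ))).trace.re := by
  unfold JCIDProtocol.detectProb JCIDProtocol.avgEncoded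
  have h : reduceTo t ((productProtocol hM hT hρ henc henc' hinst hinst' dec).transmit
      (Function.update (fun _ => JCIDProtocol.overall θ N) t (N s))
      (((productProtocol hM hT hρ henc henc' hinst hinst' dec).M : ℂ)⁻¹ •
      ∑ w, (productProtocol hM hT hρ henc henc' hinst hinst' dec).encoded w)) =
      (M : ℂ)⁻¹ • ∑ w, (tensorId (N s) B (tensorId (enc w) B ρ)).submatrix
        (Equiv.prodCongr (Equiv.refl _) (Fintype.equivFin B).symm)
        (Equiv.prodCongr (Equiv.refl _) (Fintype.equivFin B).symm) := by
    unfold JCIDProtocol.transmit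
    rw [tensorMaps_smul, tensorMaps_sum]
    refine (reduceTo_smul t _ _).trans ?_
    congr 1
    refine (reduceTo_sum t _).trans (sum_congr rfl fun w _ => ?_)
    have h1 := productProtocol_transmit_encoded hM hT hρ henc henc' hinst hinst' dec
      (Function.update (fun _ => JCIDProtocol.overall θ N) t (N s)) w
    unfold JCIDProtocol.transmit at h1
    refine (congrArg (reduceTo t) h1).trans ?_
    refine (reduceTo_tensorOp t fun t' ht' => ?_).trans ?_
    · refine (trace_submatrix_equiv _ _).trans ?_
      rw [Function.update_of_ne ht', hN.tensorId]
      exact ((henc' w).tensorId ρ).trans hρ.2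
    · rw [Function.update_self]
  refine (congrArg (fun X => Complex.re (Matrix.trace
    ((productProtocol hM hT hρ henc henc' hinst hinst' dec).inst s' X))) h).trans ?_
  rw [show ((M : ℂ)⁻¹) = (((M : ℝ)⁻¹ : ℝ) : ℂ) by push_cast; rfl]
  refine (re_trace_map_smul_sum _ _ _).trans ?_
  refine congrArg _ (sum_congr rfl fun w _ => congrArg Complex.re ?_)
  exact (congrArg Matrix.trace (relabel_submatrix _ _ _ _)).trans (trace_submatrix_equiv _ _)

end ProductProtocol

/-! ### Measurement in a complete family of vectors -/

section Measurement

open Finset Matrix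

variable {I J : Type} [Fintype I] [Fintype J] [DecidableEq J]

/-- The diagonal element of `X` at the vector `v`. -/
def quadForm (v : I → ℂ) (X : Op I) : ℂ := ∑ i, ∑ j, star (v i) * X i j * v j

/-- The instrument that measures in the basis `η`, keeps the result `z`, and outputs `f z`. -/
def basisInstrument (η : J → I → ℂ) (f : J → Fin 2) (s : Fin 2) : Op I →ₗ[ℂ] Op J :=
  krausMap fun z => Matrix.of fun r i => if r = z ∧ f z = s then star (η z i) else 0

lemma basisInstrument_apply (η : J → I → ℂ) (f : J → Fin 2) (s : Fin 2) (X : Op I) (z : J) :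
    basisInstrument η f s X z z = if f z = s then quadForm (η z) X else 0 := by
  rw [basisInstrument, krausMap_apply, Matrix.sum_apply, Fintype.sum_eq_single z]
  · simp only [Matrix.mul_apply, Matrix.conjTranspose_apply, Matrix.of_apply, true_and]
    split_ifs
    · simp only [quadForm, star_star, sum_mul]
      rw [sum_comm]
    · simp
  · intro y hy
    simp [Matrix.mul_apply, hy.symm]

lemma trace_basisInstrument (η : J → I → ℂ) (f : J → Fin 2) (s : Fin 2) (X : Op I) :
    (basisInstrument η f s X).trace = ∑ z, if f z = s then quadForm (η z) X else 0 := by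
  simp only [Matrix.trace, Matrix.diag_apply, basisInstrument_apply]

lemma sum_basisInstrument_apply (η : J → I → ℂ) (f : J → Fin 2) (X : Op I) (z : J) :
    (∑ s, basisInstrument η f s) X z z = quadForm (η z) X := by
  simp only [LinearMap.sum_apply, Matrix.sum_apply, basisInstrument_apply, sum_ite_eq, mem_univ,
    if_true]

lemma isCompletelyPositive_basisInstrument (η : J → I → ℂ) (f : J → Fin 2) (s : Fin 2) :
    IsCompletelyPositive (basisInstrument η f s) := isCompletelyPositive_krausMap _

/-- The completeness relation for `η` turns the sum of all quadratic forms into the trace. -/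
lemma isTracePreserving_basisInstrument [DecidableEq I] {η : J → I → ℂ}
    (hη : ∀ i j, ∑ z, η z i * star (η z j) = if i = j then 1 else 0) (f : J → Fin 2) :
    IsTracePreserving (∑ s, basisInstrument η f s) := by
  intro X
  simp only [Matrix.trace, Matrix.diag_apply, sum_basisInstrument_apply, quadForm]
  rw [sum_comm]
  refine sum_congr rfl fun i _ => ?_
  rw [sum_comm]
  have h : ∀ j, ∑ z, star (η z i) * X i j * η z j = X i j * if j = i then 1 else 0 := by
    intro j
    rw [← hη, mul_sum]
    exact sum_congr rfl fun z _ => by ring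
  simp_rw [h]
  simp

end Measurement

/-! ### Dense coding over the IDE channel -/

section DenseCoding

open Finset Matrix

variable {d : ℕ} {L X : Type} [Fintype L] [DecidableEq L]

/-- A classical label `l` with law `Q`, known to both sides, with a maximally entangled pair. -/
noncomputable def labelledPair (d : ℕ) (Q : L → ℝ) : Op ((L × Fin d) × (L × Fin d)) :=
  ∑ l, ((Q l / d : ℝ) : ℂ) • Matrix.vecMulVec
    (fun i : (L × Fin d) × (L × Fin d) => if i.1 = i.2 ∧ i.2.1 = l then (1 : ℂ) else 0)
    (star fun i : (L × Fin d) × (L × Fin d) => if i.1 = i.2 ∧ i.2.1 = l then (1 : ℂ) else 0)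

/-- Entries between different labels vanish: the label is classical, and only the pair within one
label is coherent. -/
lemma labelledPair_apply (Q : L → ℝ) (i j : (L × Fin d) × (L × Fin d)) :
    labelledPair d Q i j =
      if i.1 = i.2 ∧ j.1 = j.2 ∧ i.2.1 = j.2.1 then ((Q i.2.1 / d : ℝ) : ℂ) else 0 := by
  simp only [labelledPair, Matrix.sum_apply, Matrix.smul_apply, Matrix.vecMulVec_apply,
    Pi.star_apply, apply_ite star, star_one, star_zero, smul_eq_mul]
  rw [Fintype.sum_eq_single i.2.1]
  · by_cases h1 : i.1 = i.2 <;> by_cases h2 : j.1 = j.2 <;> by_cases h3 : i.2.1 = j.2.1 <;>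
      simp [h1, h2, h3, eq_comm]
  · intro l hl
    simp [hl.symm]

lemma isDensity_labelledPair (hd : 0 < d) {Q : L → ℝ} (hQ0 : ∀ l, 0 ≤ Q l) (hQ : ∑ l, Q l = 1) :
    IsDensity (labelledPair d Q) := by
  refine ⟨Matrix.posSemidef_sum _ fun l _ => ?_, ?_⟩
  · refine (Matrix.posSemidef_vecMulVec_self_star _).smul ?_
    exact_mod_cast div_nonneg (hQ0 l) (Nat.cast_nonneg d)
  · simp only [Matrix.trace, Matrix.diag_apply, labelledPair_apply, and_true, and_self]
    rw [Fintype.sum_prod_type]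
    simp only [sum_ite_eq, mem_univ, if_true]
    rw [Fintype.sum_prod_type]
    simp only [sum_const, card_univ, Fintype.card_fin, nsmul_eq_mul]
    have hd' : (d : ℝ) ≠ 0 := by positivity
    have : ∀ l, (d : ℂ) * ((Q l / d : ℝ) : ℂ) = (Q l : ℂ) := by
      intro l
      rw [← Complex.ofReal_natCast, ← Complex.ofReal_mul, mul_div_cancel₀ _ hd']
    simp_rw [this]
    exact_mod_cast hQ

/-- The encoder that applies the unitary operator `V (c l)` when the label is `l`. -/
def labelledEncoder (V : X → Op (Fin d)) (c : L → X) : Op (L × Fin d) →ₗ[ℂ] Op (Fin d) :=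
  krausMap fun l => Matrix.of fun k i => if i.1 = l then V (c l) k i.2 else 0

lemma isCompletelyPositive_labelledEncoder (V : X → Op (Fin d)) (c : L → X) :
    IsCompletelyPositive (labelledEncoder V c) := isCompletelyPositive_krausMap _

lemma isTracePreserving_labelledEncoder {V : X → Op (Fin d)} (hV : ∀ x, (V x)ᴴ * V x = 1)
    (c : L → X) : IsTracePreserving (labelledEncoder V c) := by
  refine isTracePreserving_krausMap ?_
  ext i j
  have h := fun x => congrFun (congrFun (hV x) i.2) j.2
  simp only [Matrix.mul_apply, Matrix.conjTranspose_apply] at h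
  simp only [Matrix.sum_apply, Matrix.mul_apply, Matrix.conjTranspose_apply, Matrix.of_apply,
    apply_ite star, star_zero]
  rw [Fintype.sum_eq_single i.1]
  · by_cases hij : j.1 = i.1
    · simp only [hij, if_true, h, Matrix.one_apply, Prod.ext_iff, true_and]
    · simp [hij, Prod.ext_iff, Ne.symm hij]
  · intro l hl
    simp [hl.symm]

/-- A unitary applied to half of a maximally entangled pair turns the pair into the vectorization of
that unitary, here within each label. -/
lemma tensorId_labelledEncoder_apply (V : X → Op (Fin d)) (c : L → X) (Q : L → ℝ)
    (k k' : Fin d) (j j' : L × Fin d) :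
    tensorId (labelledEncoder V c) (L × Fin d) (labelledPair d Q) (k, j) (k', j') =
      if j.1 = j'.1 then ((Q j.1 / d : ℝ) : ℂ) * (V (c j.1) k j.2 * star (V (c j.1) k' j'.2))
      else 0 := by
  rw [tensorId_apply, labelledEncoder, krausMap_apply, Matrix.sum_apply]
  have h : ∀ l, ((Matrix.of fun (k : Fin d) (i : L × Fin d) =>
      if i.1 = l then V (c l) k i.2 else 0) *
      (Matrix.of fun i i' => labelledPair d Q (i, j) (i', j')) *
      (Matrix.of fun (k : Fin d) (i : L × Fin d) => if i.1 = l then V (c l) k i.2 else 0)ᴴ) k k' =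
      if j.1 = l ∧ j'.1 = l then ((Q j.1 / d : ℝ) : ℂ) * (V (c l) k j.2 * star (V (c l) k' j'.2))
      else 0 := by
    intro l
    rw [Matrix.mul_apply, Fintype.sum_eq_single j']
    · rw [Matrix.mul_apply, Fintype.sum_eq_single j]
      · simp only [Matrix.of_apply, labelledPair_apply, true_and, Matrix.conjTranspose_apply,
          apply_ite star, star_zero]
        by_cases h1 : j.1 = l <;> by_cases h2 : j'.1 = l <;> simp [h1, h2]
        ring
      · intro i hi
        simp [labelledPair_apply, hi]
    · intro i hi
      rw [Matrix.mul_apply]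
      simp [labelledPair_apply, hi]
  simp_rw [h]
  rw [Fintype.sum_eq_single j.1]
  · simp [eq_comm]
  · intro l hl
    simp [hl.symm]

/-- The measurement basis: generalized Bell states when there is no erasure. -/
noncomputable def bellBasis (V : X → Op (Fin d)) (z : L × (X ⊕ Fin d)) :
    (Fin d ⊕ Unit) × (L × Fin d) → ℂ := fun i =>
  if i.2.1 = z.1 then
    Sum.elim (fun x => Sum.elim (fun k => (((Real.sqrt d)⁻¹ : ℝ) : ℂ) * V x k i.2.2) (fun _ => 0) i.1)
      (fun n => Sum.elim (fun _ => 0) (fun _ => if i.2.2 = n then 1 else 0) i.1) z.2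
  else 0

/-- The classical channel obtained from dense coding over the identity-depolarizing-erasure
channel. -/
noncomputable def denseChannel [DecidableEq X] (d : ℕ) (α β γ : ℝ) (x : X) : X ⊕ Fin d → ℝ :=
  Sum.elim (fun y => (if y = x then α else 0) + β / (d : ℝ) ^ 2) (fun _ => γ / d)

lemma ofReal_inv_sqrt_mul_star (d : ℕ) : (((Real.sqrt d)⁻¹ : ℝ) : ℂ) *
    star (((Real.sqrt d)⁻¹ : ℝ) : ℂ) = (d : ℂ)⁻¹ := by
  rw [Complex.star_def, Complex.conj_ofReal, ← Complex.ofReal_mul, ← mul_inv,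
    Real.mul_self_sqrt (Nat.cast_nonneg d)]
  simp

/-- Within a label the space splits into two blocks: without erasure, completeness is that of the
vectorized unitaries; after an erasure, the receiver's half is measured in the computational basis.
-/
lemma bellBasis_complete [Fintype X] {V : X → Op (Fin d)} (hd : 0 < d)
    (hV : ∀ k m k' m', ∑ x, V x k m * star (V x k' m') = if k = k' ∧ m = m' then (d : ℂ) else 0)
    (i j : (Fin d ⊕ Unit) × (L × Fin d)) :
    ∑ z, bellBasis V z i * star (bellBasis V z j) = if i = j then 1 else 0 := by
  have hd' : (d : ℂ) ≠ 0 := by exact_mod_cast hd.ne'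
  obtain ⟨k, l, m⟩ := i
  obtain ⟨k', l', m'⟩ := j
  rw [Fintype.sum_prod_type, Fintype.sum_eq_single l]
  · by_cases hl : l = l'
    · subst hl
      rw [Fintype.sum_sum_type]
      rcases k with k | k <;> rcases k' with k' | k'
      · have h : ∀ x, (((Real.sqrt d)⁻¹ : ℝ) : ℂ) * V x k m *
            star ((((Real.sqrt d)⁻¹ : ℝ) : ℂ) * V x k' m') =
            (d : ℂ)⁻¹ * (V x k m * star (V x k' m')) := by
          intro x
          rw [← ofReal_inv_sqrt_mul_star, star_mul']
          ring
        simp only [bellBasis, if_true, Sum.elim_inl, Sum.elim_inr, h, ← mul_sum, hV, zero_mul,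
          sum_const_zero, add_zero, Prod.ext_iff, Sum.inl.injEq, true_and]
        split_ifs <;> simp [hd']
      · simp [bellBasis]
      · simp [bellBasis]
      · simp [bellBasis]
    · simp [bellBasis, Ne.symm hl, hl]
  · intro l'' hl
    simp [bellBasis, hl.symm]

lemma unitary_basis_complete [Fintype X] [DecidableEq X] {V : X → Op (Fin d)} (hd : 0 < d)
    (hcard : Fintype.card X = d ^ 2)
    (hV : ∀ x y, ((V x)ᴴ * V y).trace = if x = y then (d : ℂ) else 0) (k m k' m' : Fin d) :
    ∑ x, V x k m * star (V x k' m') = if k = k' ∧ m = m' then (d : ℂ) else 0 := by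
  have hd' : (d : ℂ) ≠ 0 := by exact_mod_cast hd.ne'
  let G : Matrix (Fin d × Fin d) X ℂ := Matrix.of fun i x => V x i.1 i.2
  have h1 : ((d : ℂ)⁻¹ • Gᴴ) * G = 1 := by
    ext x y
    have h := hV x y
    simp only [Matrix.trace, Matrix.diag_apply, Matrix.mul_apply, Matrix.conjTranspose_apply] at h
    rw [Matrix.smul_mul, Matrix.smul_apply, Matrix.mul_apply, Fintype.sum_prod_type_right]
    simp only [G, Matrix.conjTranspose_apply, Matrix.of_apply, h, Matrix.one_apply]
    split_ifs <;> simp [hd']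
  -- There are as many unitaries as dimensions, so `G` is square up to reindexing and its left
  -- inverse is a right inverse: orthogonality becomes completeness.
  rw [Matrix.mul_eq_one_comm_of_equiv (Fintype.equivOfCardEq (by simp [hcard, sq]))] at h1
  have h2 := congrFun (congrFun h1 (k, m)) (k', m')
  rw [Matrix.mul_smul, Matrix.smul_apply, Matrix.mul_apply] at h2
  simp only [G, Matrix.conjTranspose_apply, Matrix.of_apply, Matrix.one_apply, Prod.ext_iff,
    smul_eq_mul] at h2
  rw [inv_mul_eq_iff_eq_mul₀ hd'] at h2
  rw [h2]
  split_ifs <;> simp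

/-- Dense coding turns the identity-depolarizing-erasure channel into a classical channel. -/
theorem quadForm_denseCoding [DecidableEq X] {V : X → Op (Fin d)} (hd : 0 < d)
    (hV₁ : ∀ x, (V x)ᴴ * V x = 1)
    (hV : ∀ x y, ((V x)ᴴ * V y).trace = if x = y then (d : ℂ) else 0)
    (α β γ : ℝ) (c : L → X) (Q : L → ℝ) (z : L × (X ⊕ Fin d)) :
    quadForm (bellBasis V z) (tensorId (ideChannel d α β γ) (L × Fin d)
      (tensorId (labelledEncoder V c) (L × Fin d) (labelledPair d Q))) =
      ((Q z.1 * denseChannel d α β γ (c z.1) z.2 : ℝ) : ℂ) := by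
  have hd' : (d : ℂ) ≠ 0 := by exact_mod_cast hd.ne'
  obtain ⟨l, y⟩ := z
  -- Whatever is encoded, the receiver's half is maximally mixed, so the depolarizing and erasure
  -- terms do not depend on the encoded symbol.
  have htr : ∀ m m' : Fin d, (Matrix.of fun k k' =>
      tensorId (labelledEncoder V c) (L × Fin d) (labelledPair d Q)
        (k, (l, m)) (k', (l, m'))).trace = if m = m' then ((Q l / d : ℝ) : ℂ) else 0 := by
    intro m m'
    have h := congrFun (congrFun (hV₁ (c l)) m') m
    simp only [Matrix.mul_apply, Matrix.conjTranspose_apply] at h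
    simp only [Matrix.trace, Matrix.diag_apply, Matrix.of_apply, tensorId_labelledEncoder_apply,
      if_true, ← mul_sum]
    simp_rw [mul_comm (V _ _ _)]
    rw [h, Matrix.one_apply]
    simp [eq_comm]
  rcases y with x | n
  -- The `α` part separates into the two conjugate inner products of `V x` and `V (c l)`; the `β`
  -- part reduces to the norm of `V x`.
  · have hs : ∀ k m k' m',
        star (bellBasis V (l, Sum.inl x) (Sum.inl k, (l, m))) *
        tensorId (ideChannel d α β γ) (L × Fin d)
        (tensorId (labelledEncoder V c) (L × Fin d) (labelledPair d Q))
          (Sum.inl k, (l, m)) (Sum.inl k', (l, m')) *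
        bellBasis V (l, Sum.inl x) (Sum.inl k', (l, m')) =
        (d : ℂ)⁻¹ * (Q l / d) * (α * ((star (V x k m) * V (c l) k m) *
          (star (V (c l) k' m') * V x k' m')) +
          if k = k' then if m = m' then β / d * (star (V x k m) * V x k' m') else 0 else 0) := by
      intro k m k' m'
      rw [tensorId_apply]
      simp only [ideChannel, LinearMap.coe_mk, AddHom.coe_mk, Matrix.fromBlocks_apply₁₁,
        Matrix.add_apply, Matrix.smul_apply, htr]
      simp only [Matrix.of_apply, tensorId_labelledEncoder_apply, if_true, bellBasis, Sum.elim_inl, smul_eq_mul,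
        Matrix.one_apply, ← ofReal_inv_sqrt_mul_star d, star_mul']
      push_cast
      split_ifs <;> ring
    have h1 := hV x (c l)
    have h2 := hV (c l) x
    have h3 := hV x x
    simp only [Matrix.trace, Matrix.diag_apply, Matrix.mul_apply, Matrix.conjTranspose_apply,
      if_true] at h1 h2 h3
    rw [sum_comm] at h1 h2 h3
    -- Both sums are restricted to the support of the Bell vector: label `l`, no erasure.
    have hq : quadForm (bellBasis V (l, Sum.inl x)) (tensorId (ideChannel d α β γ) (L × Fin d)
        (tensorId (labelledEncoder V c) (L × Fin d) (labelledPair d Q))) =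
        ∑ k, ∑ m, ∑ k', ∑ m', star (bellBasis V (l, Sum.inl x) (Sum.inl k, (l, m))) *
        tensorId (ideChannel d α β γ) (L × Fin d)
        (tensorId (labelledEncoder V c) (L × Fin d) (labelledPair d Q))
          (Sum.inl k, (l, m)) (Sum.inl k', (l, m')) *
        bellBasis V (l, Sum.inl x) (Sum.inl k', (l, m')) := by
      have hv : ∀ F : (Fin d ⊕ Unit) × (L × Fin d) → ℂ,
          (∀ i, bellBasis V (l, Sum.inl x) i = 0 → F i = 0) →
          ∑ i, F i = ∑ k, ∑ m, F (Sum.inl k, (l, m)) := by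
        intro F hF
        rw [Fintype.sum_prod_type, Fintype.sum_sum_type]
        have h0 : ∀ j, F (Sum.inr (), j) = 0 := fun j => hF _ (by simp [bellBasis])
        simp only [h0, sum_const_zero, add_zero]
        refine sum_congr rfl fun k _ => ?_
        rw [Fintype.sum_prod_type, Fintype.sum_eq_single l]
        intro l' hl'
        exact sum_eq_zero fun m _ => hF _ (by simp [bellBasis, hl'])
      unfold quadForm
      rw [hv _ fun i hi => by simp [hi]]
      refine sum_congr rfl fun k _ => sum_congr rfl fun m _ => ?_
      rw [hv _ fun i hi => by simp [hi]]
    rw [hq]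
    simp_rw [hs, ← mul_sum, sum_add_distrib, ← mul_sum]
    simp only [sum_ite_eq, mem_univ, if_true, sum_ite_irrel, sum_const_zero]
    simp_rw [← sum_mul, ← mul_sum, h1, h2, h3]
    simp only [denseChannel, Sum.elim_inl]
    by_cases hx : x = c l
    · simp only [hx, if_true]
      push_cast
      field_simp
    · simp only [hx, Ne.symm hx, if_false]
      push_cast
      field_simp
      ring
  · unfold quadForm
    rw [Fintype.sum_eq_single (Sum.inr (), (l, n)), Fintype.sum_eq_single (Sum.inr (), (l, n))]
    · rw [tensorId_apply]
      simp only [ideChannel, LinearMap.coe_mk, AddHom.coe_mk, Matrix.fromBlocks_apply₂₂,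
        Matrix.smul_apply, htr, if_true, bellBasis, Sum.elim_inr, smul_eq_mul, Matrix.one_apply,
        denseChannel, star_one, one_mul, mul_one]
      push_cast
      ring
    all_goals
      rintro ⟨k | k, l', m'⟩ hi
      · simp [bellBasis]
      · by_cases hl : l' = l
        · subst hl
          have : m' ≠ n := by rintro rfl; exact hi rfl
          simp [bellBasis, this]
        · simp [bellBasis, hl]

end DenseCoding

/-! ### The averaged channel -/

section IdeChannel

open Finset Matrix

/-- The channel is linear in its parameters, so averaging over the unknown state stays within the
IDE family and decoding needs no separate analysis. -/
lemma overall_ideChannel (d : ℕ) (θ α β γ : Fin 2 → ℝ) :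
    JCIDProtocol.overall θ (fun s => ideChannel d (α s) (β s) (γ s)) =
      ideChannel d (θ 0 * α 0 + θ 1 * α 1) (θ 0 * β 0 + θ 1 * β 1) (θ 0 * γ 0 + θ 1 * γ 1) := by
  refine LinearMap.ext fun X => ?_
  ext i j
  rcases i with i | i <;> rcases j with j | j <;>
    simp [JCIDProtocol.overall, ideChannel, Fin.sum_univ_two] <;> ring

lemma isTracePreserving_ideChannel {d : ℕ} (hd : 0 < d) {α β γ : ℝ} (h : α + β + γ = 1) :
    IsTracePreserving (ideChannel d α β γ) := by
  intro X
  have hd' : (d : ℂ) ≠ 0 := by exact_mod_cast hd.ne'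
  have h' : (α : ℂ) + β + γ = 1 := by exact_mod_cast h
  have ht : ∀ (Y : Op (Fin d)) (Z : Op Unit),
      (Matrix.fromBlocks Y 0 0 Z).trace = Y.trace + Z.trace := fun Y Z => by
    simp [Matrix.trace]
  simp only [ideChannel, LinearMap.coe_mk, AddHom.coe_mk, ht,
    Matrix.trace_add, Matrix.trace_smul, Matrix.trace_one, smul_eq_mul, Fintype.card_fin,
    Fintype.card_unit, Nat.cast_one, mul_one]
  field_simp
  linear_combination X.trace * h'

end IdeChannel

/-! ### Achievability from the classical channel -/

section Achievability

open Finset Matrix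

variable {d : ℕ} {U X : Type} [DecidableEq X]

lemma denseChannel_nonneg {α β γ : ℝ} (hα : 0 ≤ α) (hβ : 0 ≤ β) (hγ : 0 ≤ γ) (x : X)
    (y : X ⊕ Fin d) : 0 ≤ denseChannel d α β γ x y := by
  rcases y with y | y
  · simp only [denseChannel, Sum.elim_inl]
    split_ifs <;> positivity
  · simp only [denseChannel, Sum.elim_inr]
    positivity

variable [Fintype X]

lemma sum_denseChannel (hd : 0 < d) (hcard : Fintype.card X = d ^ 2) {α β γ : ℝ}
    (h : α + β + γ = 1) (x : X) : ∑ y, denseChannel d α β γ x y = 1 := by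
  have hd' : (d : ℝ) ≠ 0 := by positivity
  simp only [denseChannel, Fintype.sum_sum_type, Sum.elim_inl, Sum.elim_inr, sum_add_distrib,
    sum_ite_eq', mem_univ, if_true, sum_const, card_univ, hcard, Fintype.card_fin, nsmul_eq_mul]
  push_cast
  field_simp
  exact h

lemma outLaw_denseChannel_inl {p : U → X → ℝ} (hp : ∀ u, ∑ x, p u x = 1) (α β γ : ℝ) (u : U)
    (y : X) : outLaw p (denseChannel d α β γ) u (Sum.inl y) = α * p u y + β / (d : ℝ) ^ 2 := by
  simp only [outLaw, denseChannel, Sum.elim_inl, mul_add, sum_add_distrib, ← sum_mul, hp, mul_ite,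
    mul_zero, sum_ite_eq, mem_univ, if_true]
  ring

lemma outLaw_denseChannel_inr {p : U → X → ℝ} (hp : ∀ u, ∑ x, p u x = 1) (α β γ : ℝ) (u : U)
    (n : Fin d) : outLaw p (denseChannel d α β γ) u (Sum.inr n) = γ / d := by
  simp only [outLaw, denseChannel, Sum.elim_inr, ← sum_mul, hp, one_mul]

/-- The mutual information of the classical channel obtained from dense coding. -/
lemma info_denseChannel (hcard : Fintype.card X = d ^ 2) {p : U → X → ℝ}
    (hp : ∀ u, ∑ x, p u x = 1) (α β γ : ℝ) (u : U) :
    ∑ x, p u x * ∑ y, denseChannel d α β γ x y * (Real.logb 2 (denseChannel d α β γ x y) -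
      Real.logb 2 (outLaw p (denseChannel d α β γ) u y)) =
    -∑ y, xlog2 (p u y * α + β / (d : ℝ) ^ 2) + xlog2 (α + β / (d : ℝ) ^ 2) +
      ((d : ℝ) ^ 2 - 1) * xlog2 (β / (d : ℝ) ^ 2) := by
  -- By symmetry the conditional entropy of the unerased outputs is the same for every input.
  have h1 : ∀ x : X, ∑ y, denseChannel d α β γ x (Sum.inl y) *
      Real.logb 2 (denseChannel d α β γ x (Sum.inl y)) =
      xlog2 (α + β / (d : ℝ) ^ 2) + ((d : ℝ) ^ 2 - 1) * xlog2 (β / (d : ℝ) ^ 2) := by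
    intro x
    have h : ∀ y, denseChannel d α β γ x (Sum.inl y) *
        Real.logb 2 (denseChannel d α β γ x (Sum.inl y)) = xlog2 (β / (d : ℝ) ^ 2) +
        if y = x then xlog2 (α + β / (d : ℝ) ^ 2) - xlog2 (β / (d : ℝ) ^ 2) else 0 := by
      intro y
      simp only [denseChannel, Sum.elim_inl, xlog2]
      split_ifs <;> simp
    simp_rw [h]
    rw [sum_add_distrib, sum_ite_eq', if_pos (mem_univ x), sum_const, card_univ, hcard,
      nsmul_eq_mul]
    push_cast
    ring
  have h2 : ∑ x, p u x * ∑ y, denseChannel d α β γ x (Sum.inl y) *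
      Real.logb 2 (outLaw p (denseChannel d α β γ) u (Sum.inl y)) =
      ∑ y, xlog2 (p u y * α + β / (d : ℝ) ^ 2) := by
    simp_rw [mul_sum]
    rw [sum_comm]
    refine sum_congr rfl fun y _ => ?_
    simp_rw [← mul_assoc]
    rw [← sum_mul]
    change outLaw p (denseChannel d α β γ) u (Sum.inl y) * _ = _
    rw [outLaw_denseChannel_inl hp, xlog2, mul_comm α]
  -- Erasures are equally likely for all inputs and carry no information.
  have h3 : ∀ (x : X) (n : Fin d), denseChannel d α β γ x (Sum.inr n) *
      (Real.logb 2 (denseChannel d α β γ x (Sum.inr n)) -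
      Real.logb 2 (outLaw p (denseChannel d α β γ) u (Sum.inr n))) = 0 := by
    intro x n
    rw [outLaw_denseChannel_inr hp]
    simp [denseChannel]
  simp_rw [Fintype.sum_sum_type, h3, sum_const_zero, add_zero, mul_sub, sum_sub_distrib, h1,
    mul_sub, sum_sub_distrib, h2]
  rw [← sum_mul, hp]
  ring

/-- The error of the Bayes rule for the channel state, given the channel output. -/
noncomputable def bayesError {U X Y : Type} [Fintype U] [Fintype X] [Fintype Y] (q : U → ℝ) (p : U → X → ℝ) (π : Fin 2 → ℝ)
    (W : Fin 2 → X → Y → ℝ) : ℝ :=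
  ∑ u, q u * ∑ y, min (π 0 * outLaw p (W 0) u y) (π 1 * outLaw p (W 1) u y)

/-- Achievability by dense coding with a shared random code and a shared time-sharing variable. -/
theorem mem_achievableRegion_of_denseCoding [Fintype U] [DecidableEq U] (hd : 0 < d) {α β γ θ π : Fin 2 → ℝ}
    (hα : ∀ s, 0 ≤ α s) (hβ : ∀ s, 0 ≤ β s) (hγ : ∀ s, 0 ≤ γ s)
    (hsum : ∀ s, α s + β s + γ s = 1) (hθ : ∀ s, 0 ≤ θ s) (hθsum : θ 0 + θ 1 = 1)
    {V : X → Op (Fin d)} (hcard : Fintype.card X = d ^ 2) (hV₁ : ∀ x, (V x)ᴴ * V x = 1)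
    (hV : ∀ x y, ((V x)ᴴ * V y).trace = if x = y then (d : ℂ) else 0)
    {q : U → ℝ} {p : U → X → ℝ} (hq0 : ∀ u, 0 ≤ q u) (hq : ∑ u, q u = 1)
    (hp0 : ∀ u x, 0 ≤ p u x) (hp : ∀ u, ∑ x, p u x = 1) {x : ℝ × ℝ}
    (hR : x.1 ≤ meanInfo q p (denseChannel d (θ 0 * α 0 + θ 1 * α 1) (θ 0 * β 0 + θ 1 * β 1)
      (θ 0 * γ 0 + θ 1 * γ 1)))
    (hE : bayesError q p π (fun s => denseChannel d (α s) (β s) (γ s)) ≤ x.2) :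
    x ∈ achievableRegion θ π (fun s => ideChannel d (α s) (β s) (γ s)) := by
  intro ε hε
  have havg : ∀ a : Fin 2 → ℝ, (∀ s, 0 ≤ a s) → 0 ≤ θ 0 * a 0 + θ 1 * a 1 := fun a ha =>
    add_nonneg (mul_nonneg (hθ 0) (ha 0)) (mul_nonneg (hθ 1) (ha 1))
  have hbar : (θ 0 * α 0 + θ 1 * α 1) + (θ 0 * β 0 + θ 1 * β 1) + (θ 0 * γ 0 + θ 1 * γ 1) = 1 := by
    linear_combination θ 0 * hsum 0 + θ 1 * hsum 1 + hθsum
  obtain ⟨M, T, hM, hT, hrate, dec, hdec⟩ := exists_random_code hq0 hq hp0 hp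
    (denseChannel_nonneg (X := X) (d := d) (havg α hα) (havg β hβ) (havg γ hγ))
    (sum_denseChannel hd hcard hbar) (R := x.1 - ε) (by linarith) hε
  -- The label holds the time-sharing symbol and the current symbols of all codewords; message `w`
  -- will use the `w`-th one.
  let Q : U × (Fin M → X) → ℝ := fun l => q l.1 * ∏ i, p l.1 (l.2 i)
  have hQ0 : ∀ l, 0 ≤ Q l := fun l => mul_nonneg (hq0 _) (prod_nonneg fun i _ => hp0 _ _)
  have hQ : ∑ l, Q l = 1 := by
    simp only [Q, Fintype.sum_prod_type, ← mul_sum]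
    have : ∀ u, ∑ xs : Fin M → X, ∏ i, p u (xs i) = 1 := by
      intro u
      rw [← Fintype.prod_sum (fun _ : Fin M => p u)]
      simp [hp]
    simp [this, hq]
  -- The Bayes decision uses `u` and the outcome, but not the codebook.
  let g : U → X ⊕ Fin d → Fin 2 := fun u y =>
    if π 1 * outLaw p (denseChannel d (α 1) (β 1) (γ 1)) u y ≤
      π 0 * outLaw p (denseChannel d (α 0) (β 0) (γ 0)) u y then 0 else 1
  let f : (U × (Fin M → X)) × (X ⊕ Fin d) → Fin 2 := fun z => g z.1.1 z.2
  have hη := bellBasis_complete (L := U × (Fin M → X)) hd (unitary_basis_complete hd hcard hV)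
  let P : JCIDProtocol d (Fin d ⊕ Unit) := productProtocol hM hT
    (isDensity_labelledPair hd hQ0 hQ)
    (fun w => isCompletelyPositive_labelledEncoder V (fun l : U × (Fin M → X) => l.2 w))
    (fun w => isTracePreserving_labelledEncoder hV₁ (fun l : U × (Fin M → X) => l.2 w))
    (isCompletelyPositive_basisInstrument (bellBasis V) f)
    (isTracePreserving_basisInstrument hη f)
    (fun z => dec fun t => Equiv.prodAssoc _ _ _ (z t))
  have hlaw : ∀ (W : X → X ⊕ Fin d → ℝ) (w : Fin M) (z : (U × (Fin M → X)) × (X ⊕ Fin d)),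
      Q z.1 * W (z.1.2 w) z.2 = codeLaw q p W w (Equiv.prodAssoc _ _ _ z) := by
    intro W w z
    simp only [Q, codeLaw, Equiv.prodAssoc_apply]
    ring
  refine ⟨P, hrate, ?_, ?_⟩
  · have : Nonempty (Fin P.M) := ⟨⟨0, hM⟩⟩
    refine ciSup_le fun w => ?_
    refine le_trans (le_of_eq ?_) (hdec w)
    have hdp : ∀ w' : Fin M, P.decodeProb θ (fun s => ideChannel d (α s) (β s) (γ s)) w w' =
        ∑ z, if dec z = w' then ∏ t, codeLaw q p (denseChannel d (θ 0 * α 0 + θ 1 * α 1)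
          (θ 0 * β 0 + θ 1 * β 1) (θ 0 * γ 0 + θ 1 * γ 1)) w (z t) else 0 := by
      intro w'
      refine (productProtocol_decodeProb (M := M) (T := T) hM hT _ _ _ _ _ _ θ _ w w').trans ?_
      rw [Complex.re_sum]
      refine Fintype.sum_equiv (Equiv.arrowCongr (Equiv.refl (Fin T)) (Equiv.prodAssoc _ _ _))
        _ _ fun z => ?_
      simp only [sum_basisInstrument_apply, overall_ideChannel, quadForm_denseCoding hd hV₁ hV]
      rw [apply_ite Complex.re, ← Complex.ofReal_prod, Complex.ofReal_re, Complex.zero_re]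
      refine if_congr Iff.rfl (prod_congr rfl fun t _ => ?_) rfl
      exact hlaw _ w (z t)
    have herr : ∀ (v : Fin M) (F : (Fin T → U × (Fin M → X) × (X ⊕ Fin d)) → ℝ),
        ∑ w' ∈ univ.erase v, ∑ z, (if dec z = w' then F z else 0) =
          ∑ z, if dec z = v then 0 else F z := by
      intro v F
      rw [sum_comm]
      refine sum_congr rfl fun z _ => ?_
      rw [sum_ite_eq]
      by_cases h : dec z = v
      · rw [if_pos h, if_neg (by rw [h]; exact notMem_erase _ _)]
      · rw [if_neg h, if_pos (mem_erase.2 ⟨h, mem_univ _⟩)]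
    exact (sum_congr rfl fun w' _ => hdp w').trans (herr w _)
  · have : Nonempty (Fin P.T) := ⟨⟨0, hT⟩⟩
    refine ciSup_le fun t => le_trans (le_of_eq ?_) hE
    have hdp : ∀ s s' : Fin 2, P.detectProb θ (fun s => ideChannel d (α s) (β s) (γ s)) t s s' =
        ∑ u, q u * ∑ y, if g u y = s' then outLaw p (denseChannel d (α s) (β s) (γ s)) u y
          else 0 := by
      intro s s'
      refine (productProtocol_detectProb _ _ _ _ _ _ _ _
        (by rw [overall_ideChannel]; exact isTracePreserving_ideChannel hd hbar) t s s').trans ?_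
      have hw : ∀ w : Fin M, (basisInstrument (bellBasis V) f s' (tensorId (ideChannel d (α s) (β s)
          (γ s)) _ (tensorId (labelledEncoder V fun l : U × (Fin M → X) => l.2 w) _
          (labelledPair d Q)))).trace.re = ∑ u, q u * ∑ y, if g u y = s' then
            outLaw p (denseChannel d (α s) (β s) (γ s)) u y else 0 := by
        intro w
        rw [trace_basisInstrument, Complex.re_sum]
        -- Summing out the codebook leaves the symbol law `p u`, the same for every message, so the
        -- average over messages is trivial.
        have h := sum_codeLaw_mul q hp (denseChannel d (α s) (β s) (γ s)) w
          (fun u _ y => if g u y = s' then 1 else 0)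
        rw [← (Equiv.prodAssoc U (Fin M → X) (X ⊕ Fin d)).sum_comp] at h
        refine (sum_congr rfl fun z _ => ?_).trans (h.trans (sum_congr rfl fun u _ => ?_))
        · rw [← hlaw, quadForm_denseCoding hd hV₁ hV, apply_ite Complex.re, Complex.ofReal_re,
            Complex.zero_re, mul_ite, mul_one, mul_zero]
          rfl
        · congr 1
          simp_rw [mul_sum]
          rw [sum_comm]
          refine sum_congr rfl fun y _ => ?_
          split_ifs <;> simp [outLaw]
      simp_rw [hw]
      rw [sum_const, card_univ, Fintype.card_fin, nsmul_eq_mul, inv_mul_cancel_left₀]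
      exact_mod_cast hM.ne'
    rw [hdp, hdp, bayesError, mul_sum, mul_sum, ← sum_add_distrib]
    refine sum_congr rfl fun u _ => ?_
    rw [mul_left_comm, mul_left_comm (π 1), ← mul_add, mul_sum, mul_sum, ← sum_add_distrib]
    congr 1
    refine sum_congr rfl fun y _ => ?_
    -- In each case the rule leaves exactly the smaller weighted likelihood as error.
    by_cases h : π 1 * outLaw p (denseChannel d (α 1) (β 1) (γ 1)) u y ≤
        π 0 * outLaw p (denseChannel d (α 0) (β 0) (γ 0)) u y
    · simp [g, h]
    · simp [g, h, (not_le.1 h).le]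

end Achievability

/-! ### Two-level input laws and the explicit region -/

section TwoLevel

open Finset

/-- The function that is `a` on the first `n` points and `b` on the others. -/
def twoLevel {D : ℕ} (n : ℕ) (a b : ℝ) (x : Fin D) : ℝ := if (x : ℕ) < n then a else b

lemma sum_twoLevel {D n : ℕ} (hn : n ≤ D) (a b : ℝ) (F : ℝ → ℝ) :
    ∑ x : Fin D, F (twoLevel n a b x) = n * F a + ((D : ℝ) - n) * F b := by
  obtain ⟨m, rfl⟩ := Nat.exists_eq_add_of_le hn
  rw [Fin.sum_univ_add]
  simp [twoLevel]

/-- The minimum is homogeneous, so the `d` erasure outcomes of weight `γ / d` recombine into the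
single erasure term. -/
lemma sum_min_denseChannel {d : ℕ} {U : Type} (hd : 0 < d)
    {α β γ π : Fin 2 → ℝ} {n : ℕ} (hn : n ≤ d ^ 2) {p : U → Fin (d ^ 2) → ℝ}
    (hp : ∀ u, ∑ x, p u x = 1) {u : U} {p₁ p₂ : ℝ} (hpu : p u = twoLevel n p₁ p₂) :
    ∑ y, min (π 0 * outLaw p (denseChannel d (α 0) (β 0) (γ 0)) u y)
      (π 1 * outLaw p (denseChannel d (α 1) (β 1) (γ 1)) u y) =
    (n : ℝ) * min (π 0 * α 0 * p₁ + π 0 * β 0 / ((d ^ 2 : ℕ) : ℝ))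
        (π 1 * α 1 * p₁ + π 1 * β 1 / ((d ^ 2 : ℕ) : ℝ))
      + (((d ^ 2 : ℕ) : ℝ) - n) *
        min (π 0 * α 0 * p₂ + π 0 * β 0 / ((d ^ 2 : ℕ) : ℝ))
          (π 1 * α 1 * p₂ + π 1 * β 1 / ((d ^ 2 : ℕ) : ℝ))
      + min (π 0 * γ 0) (π 1 * γ 1) := by
  have hd' : (0 : ℝ) < d := by exact_mod_cast hd
  simp only [Fintype.sum_sum_type, outLaw_denseChannel_inl hp, outLaw_denseChannel_inr hp]
  rw [← sum_twoLevel hn p₁ p₂ fun v => min (π 0 * α 0 * v + π 0 * β 0 / ((d ^ 2 : ℕ) : ℝ))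
        (π 1 * α 1 * v + π 1 * β 1 / ((d ^ 2 : ℕ) : ℝ)), ← hpu]
  congr 1
  · refine sum_congr rfl fun y _ => ?_
    push_cast
    congr 1 <;> ring
  · rw [← mul_div_assoc, ← mul_div_assoc, min_div_div_right hd'.le]
    simp only [sum_const, card_univ, Fintype.card_fin, nsmul_eq_mul]
    field_simp

end TwoLevel

theorem theorem3 (d : ℕ) (hd : 0 < d) (α β γ θ π : Fin 2 → ℝ)
    (hα : ∀ s, 0 ≤ α s) (hβ : ∀ s, 0 ≤ β s) (hγ : ∀ s, 0 ≤ γ s)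
    (hsum : ∀ s, α s + β s + γ s = 1)
    (hθ : ∀ s, 0 ≤ θ s) (hθsum : θ 0 + θ 1 = 1)
    (hπ : ∀ s, 0 < π s) (hπsum : π 0 + π 1 = 1) :
    region1 (d ^ 2) α β γ θ π ⊆
      achievableRegion θ π (fun s => ideChannel d (α s) (β s) (γ s)) := by
  classical
  intro x hx
  -- The index set of the convex combination becomes the time-sharing alphabet, and its weights the
  -- law `q`.
  rw [region1, mem_convexHull_iff_exists_fintype] at hx
  obtain ⟨U, _, q, z, hq0, hq, hz, rfl⟩ := hx
  choose n p₁ p₂ hn1 hnD hp1 _ hp2 _ hpsum hzR hzE using hz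
  obtain ⟨V, hV₁, hV⟩ := exists_unitary_basis d hd
  let p : U → Fin (d ^ 2) → ℝ := fun u => twoLevel (n u) (p₁ u) (p₂ u)
  have hp : ∀ u, ∑ y, p u y = 1 := fun u =>
    (sum_twoLevel (hnD u) (p₁ u) (p₂ u) id).trans (hpsum u)
  have hp0 : ∀ u y, 0 ≤ p u y := by
    intro u y
    simp only [p, twoLevel]
    split_ifs
    exacts [hp1 u, hp2 u]
  refine mem_achievableRegion_of_denseCoding hd hα hβ hγ hsum hθ hθsum (Fintype.card_fin _)
    hV₁ hV hq0 hq hp0 hp ?_ ?_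
  · rw [Prod.fst_sum, meanInfo]
    refine Finset.sum_le_sum fun u _ => mul_le_mul_of_nonneg_left ((hzR u).trans (le_of_eq ?_))
      (hq0 u)
    rw [info_denseChannel (Fintype.card_fin _) hp,
      sum_twoLevel (hnD u) (p₁ u) (p₂ u) fun v => xlog2 (v * _ + _)]
    push_cast
    ring
  · rw [Prod.snd_sum, bayesError]
    refine Finset.sum_le_sum fun u _ => mul_le_mul_of_nonneg_left ((le_of_eq ?_).trans (hzE u))
      (hq0 u)
    exact sum_min_denseChannel hd (hnD u) hp rfl
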